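/- **Theorem 3.3 (Weierstrass $\wp$ orbit to first order in $\mu_2$).** Let $\mu_1>0$, $r_0>0$, $L\neq 0$ and $-\dfrac{\mu_1^2}{2L^2}<E<0$ be fixed, and let $\mu_2>0$ be a small parameter. Two primaries of gravitational masses $\mu_1,\mu_2$ move on circles about their mass centre $O$; the second circle has radius $r_0$, and $a_0=r_0+\mu_2r_0/\mu_1$ is the distance of the primaries. An *isosceles-triangle orbit* of the asteroid is a motion $t\mapsto(\rho(t),\phi(t))$, $t\in\mathbb R$, in polar coordinates about $O$ with $\rho>0$ and $$\rho^2\dot\phi=L,\qquad \ddot\rho-\frac{L^2}{\rho^3}=-\frac{(\mu_1+\mu_2)\rho}{(\rho^2+c^2)^{3/2}},\qquad \frac{\dot\rho^2}{2}+\frac{L^2}{2\rho^2}-\frac{\mu_1+\mu_2}{\sqrt{\rho^2+c^2}}=E,\qquad c^2=\frac{\mu_1\mu_2a_0^2}{(\mu_1+\mu_2)^2}.$$ A *first-order orbit* is a motion with $\rho>0$, $\rho^2\dot\phi=L$ and energy $E$ in the potential expanded to first order, $-\dfrac{\mu_1+\mu_2}{\rho}+\dfrac{\mu_2r_0^2}{2\rho^3}$,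 i.e. $$\ddot\rho-\frac{L^2}{\rho^3}=-\frac{\mu_1+\mu_2}{\rho^2}+\frac{3\mu_2r_0^2}{2\rho^4},\qquad \frac{\dot\rho^2}{2}+\frac{L^2}{2\rho^2}-\frac{\mu_1+\mu_2}{\rho}+\frac{\mu_2r_0^2}{2\rho^3}=E.$$ Put $$C(\rho)=\rho^3+\frac{\mu_1+\mu_2}{E}\rho^2-\frac{L^2}{2E}\rho-\frac{\mu_2r_0^2}{2E},\qquad g_2=\frac{L^4}{48}+\frac{\mu_1\mu_2r_0^2}{8},\qquad g_3=\frac{\mu_1\mu_2L^2r_0^2}{192}+\frac{L^6}{1728}.$$ There are $\delta>0$ and $K$, depending only on $\mu_1,r_0,L,E$, such that for all $0<\mu_2<\delta$: 1. the roots of the cubic $C$ are real numbers $\rho_{\max}>\rho_{\min}>0>\rho_3$, and there is a lattice in $\mathbb C$ with invariants $g_2,g_3$, so that $\wp(\,\cdot\,;g_2,g_3)$ exists; 2. on every first-order orbit, $\rho_{\max}$ and $\rho_{\min}$ are the maximum and the minimum of $\rho$, and $\rho_{\min}<\rho<\rho_{\max}$ exactly at the times when $\dot\rho\neq0$ (between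 the apsides); 3. on every isosceles-triangle orbit, $\rho$ attains a maximum and a minimum, which differ from $\rho_{\max}$ and $\rho_{\min}$ by at most $K\mu_2^2$. Moreover, correct to first order in $\mu_2$, the equation of the orbit is $$\frac1\rho-\frac1{\rho_{\max}}=\frac14\left(\mu_1+\mu_2-\frac{3\mu_2r_0^2}{2\rho_{\max}^2}-\frac{L^2}{\rho_{\max}}\right)\left[\wp\!\left(\frac{\sqrt2}{L}(\phi-\phi_0);g_2,g_3\right)+\frac1{24}\left(\frac{3\mu_2r_0^2}{\rho_{\max}}+L^2\right)\right]^{-1},$$ where $\phi_0$ is the value of $\phi$ at a time when $\rho$ is maximal, and $[\,\cdot\,]^{-1}=0$ at the poles of $\wp$. Precisely: for every $A$ there are $\delta'\in(0,\delta]$ and $K'$, depending only on $A,\mu_1,r_0,L,E$ (and $\delta$), such that for all $0<\mu_2<\delta'$, for every isosceles-triangle orbit and for every first-order orbit, at all points with $|\phi-\phi_0|\le A$, the bracket is nonzero away from the poles of $\wp$, and the two sides differ by at most $K'\mu_2^2$. -/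

import Mathlib

/-- Distance `a₀ = r₁ + r₂` between the two primaries on circular orbits about their mass centre,
where `r₂ = r₀` is the radius of the orbit of the second body and `μ₁ r₁ = μ₂ r₂`. -/
noncomputable def separation (μ₁ μ₂ r₀ : ℝ) : ℝ := μ₂ * r₀ / μ₁ + r₀

/-- `c² = μ₁ μ₂ a₀² / (μ₁ + μ₂)²`, so that `ρ² + c²` is the square of the equal side of the
isosceles triangle. -/
noncomputable def cSq (μ₁ μ₂ r₀ : ℝ) : ℝ :=
  μ₁ * μ₂ * separation μ₁ μ₂ r₀ ^ 2 / (μ₁ + μ₂) ^ 2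

/-- Planar motion `t ↦ (ρ t, φ t)` in polar coordinates of a unit mass, with constant angular
momentum `L`, under the radial force `f`, and with total energy `E` for the potential `V`
(which is meant to satisfy `f = -V'` on `(0, ∞)`). -/
structure IsCentralMotion (f V : ℝ → ℝ) (L E : ℝ) (ρ φ : ℝ → ℝ) : Prop where
  pos : ∀ t, 0 < ρ t
  angular : ∀ t, HasDerivAt φ (L / ρ t ^ 2) t
  differentiable : Differentiable ℝ ρ
  radial : ∀ t, HasDerivAt (deriv ρ) (L ^ 2 / ρ t ^ 3 + f (ρ t)) t
  energy : ∀ t, deriv ρ t ^ 2 / 2 + L ^ 2 / (2 * ρ t ^ 2) + V (ρ t) = E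

/-- The isosceles triangle orbit of the asteroid when the primaries move on circles:
`ρ² φ' = L`, `ρ'' - L² / ρ³ = - (μ₁ + μ₂) ρ / (ρ² + c²)^(3/2)`, with energy
`E = ρ'² / 2 + L² / (2 ρ²) - (μ₁ + μ₂) / (ρ² + c²)^(1/2)`. -/
def IsIsoscelesOrbit (μ₁ μ₂ r₀ L E : ℝ) (ρ φ : ℝ → ℝ) : Prop :=
  IsCentralMotion
    (fun x => -((μ₁ + μ₂) * x / √(x ^ 2 + cSq μ₁ μ₂ r₀) ^ 3))
    (fun x => -((μ₁ + μ₂) / √(x ^ 2 + cSq μ₁ μ₂ r₀))) L E ρ φ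

/-- The orbit obtained by expanding the potential to first order in `μ₂`:
`V = - (μ₁ + μ₂) / ρ + μ₂ r₀² / (2 ρ³)`. For `u = 1 / ρ` as a function of `φ` the energy equation
reads `(L² / 2) (du/dφ)² = E + (μ₁ + μ₂) u - (L² / 2) u² - (μ₂ r₀² / 2) u³`. -/
def IsFirstOrderOrbit (μ₁ μ₂ r₀ L E : ℝ) (ρ φ : ℝ → ℝ) : Prop :=
  IsCentralMotion
    (fun x => -((μ₁ + μ₂) / x ^ 2) + 3 * μ₂ * r₀ ^ 2 / (2 * x ^ 4))
    (fun x => -((μ₁ + μ₂) / x) + μ₂ * r₀ ^ 2 / (2 * x ^ 3)) L E ρ φ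

/-- The cubic `C(ρ)`. -/
noncomputable def orbitCubic (μ₁ μ₂ r₀ L E x : ℝ) : ℝ :=
  x ^ 3 + (μ₁ + μ₂) / E * x ^ 2 - L ^ 2 / (2 * E) * x - μ₂ * r₀ ^ 2 / (2 * E)

/-- The invariant `g₂`. -/
noncomputable def invG₂ (μ₁ μ₂ r₀ L : ℝ) : ℝ := L ^ 4 / 48 + μ₁ * μ₂ * r₀ ^ 2 / 8

/-- The invariant `g₃`. -/
noncomputable def invG₃ (μ₁ μ₂ r₀ L : ℝ) : ℝ :=
  μ₁ * μ₂ * L ^ 2 * r₀ ^ 2 / 192 + L ^ 6 / 1728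

/-- `Λ` has the invariants `g₂`, `g₃` above, so that `Λ.weierstrassP z` is `℘(z; g₂, g₃)`. -/
def HasInvariants (Λ : PeriodPair) (μ₁ μ₂ r₀ L : ℝ) : Prop :=
  Λ.g₂ = (invG₂ μ₁ μ₂ r₀ L : ℂ) ∧ Λ.g₃ = (invG₃ μ₁ μ₂ r₀ L : ℂ)

/-- The argument `z = (√2 / L) ψ` of `℘`, with `ψ = φ - φ₀`. -/
noncomputable def orbitArg (L ψ : ℝ) : ℂ := ((√2 / L * ψ : ℝ) : ℂ)

/-- The bracket `℘(z; g₂, g₃) + (3 μ₂ r₀² / ρmax + L²) / 24`. -/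
noncomputable def orbitBracket (Λ : PeriodPair) (μ₂ r₀ L ρmax ψ : ℝ) : ℂ :=
  Λ.weierstrassP (orbitArg L ψ) + ((1 / 24 * (3 * μ₂ * r₀ ^ 2 / ρmax + L ^ 2) : ℝ) : ℂ)

open Classical in
/-- The right-hand side of the orbit formula. At the poles of `℘`, i.e. at the lattice points,
where the bracket is infinite, its inverse is `0`. -/
noncomputable def orbitFormula (Λ : PeriodPair) (μ₁ μ₂ r₀ L ρmax ψ : ℝ) : ℂ :=
  if orbitArg L ψ ∈ Λ.lattice then 0
  else ((1 / 4 * (μ₁ + μ₂ - 3 * μ₂ * r₀ ^ 2 / (2 * ρmax ^ 2) - L ^ 2 / ρmax) : ℝ) : ℂ) *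
    (orbitBracket Λ μ₂ r₀ L ρmax ψ)⁻¹

/-!
In the variable `u = 1 / ρ`, as a function of the polar angle, both kinds of orbits satisfy
`(L² / 2) (du/dφ)² = Q(u)` and `L² d²u/dφ² = Q'(u)`, where `Q` is concave on `[0, ∞)`, negative
at `0` and positive at `μ₁ / L²`. So `Q` has exactly two positive roots, both simple, and `ρ` oscillates
between their inverses: without turning points after some time, `ρ` would converge to a position
where both the radial velocity and the radial acceleration vanish, and there is none
(`IsCentralMotion.range_of_concaveWell`). The two functions `Q` differ by `O(μ₂²)` on bounded sets
(`abs_energy_sub_le`), and concavity turns this into a bound for the roots (`exists_roots_close`).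
The cubic `C` is `ρ³ Q(1 / ρ) / E` for the first-order `Q` (`orbitCubic_eq`).

The discriminant `g₂³ - 27 g₃²` is positive, and real invariants with positive discriminant belong to
a rectangular lattice (`exists_periodPair_of_discriminant_pos`): by the `q`-expansions of the
Eisenstein series and the intermediate value theorem, `g₃² / g₂³` takes on the rectangles `1 × y`
all values between `0`, its value on the square, and `1 / 27`, its limit for `y → ∞`.

For the orbit formula, let `b` be the shift in the bracket. The function `y = 1 / (℘ + b)`, which is
zero at the poles of `℘`, satisfies
`y'' = 2 - 12 b y + (3/2) (12 b² - g₂) y² + 2 (-4 b³ + g₂ b - g₃) y³`, `y(0) = y'(0) = 0`, and this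
equation is regular at the lattice points (`PeriodPair.hasDerivAt_deriv_recipWeierstrassP`). In the
variable `φ` the equation is `y'' = 4 / L² - y` up to `O(μ₂)`, because the lattice degenerates
for `μ₂ → 0`. Hence Grönwall's inequality bounds `y` on a given interval, which excludes
zeros of the bracket there (`PeriodPair.recipWeierstrassP_regular_and_bounded`). With `c` a quarter
of the slope of `Q` at `u₀ = 1 / ρmax`, the function `u₀ + c y` solves the first-order orbit equation up
to an error `O(μ₂²)`, the error that comes from truncating `g₂` and `g₃`
(`recipForce_eq_slope`); a second use of Grönwall's inequality, in time, compares it with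
`1 / ρ` (`exists_orbit_estimate`). All of this is done with complex values, so no reality
properties of `℘` are needed.
-/

/-! ### Existence of lattices with given real invariants -/

section RectangularLattices

open Filter Topology

/-- The divisor series `∑ σ_k(n) qⁿ` on the imaginary axis, i.e. with `q = exp (-2πy)`. -/
noncomputable def divisorSeries (k : ℕ) (y : ℝ) : ℝ :=
  ∑' n : ℕ+, (ArithmeticFunction.sigma k n : ℝ) * Real.exp (-2 * Real.pi * y) ^ (n : ℕ)

theorem summable_divisorSeries (k : ℕ) :
    Summable fun n : ℕ+ =>
      (ArithmeticFunction.sigma k n : ℝ) * Real.exp (-2 * Real.pi) ^ (n : ℕ) := by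
  have hr : ‖Real.exp (-2 * Real.pi)‖ < 1 := by
    rw [Real.norm_of_nonneg (Real.exp_nonneg _), Real.exp_lt_one_iff]
    nlinarith [Real.pi_pos]
  have h := summable_norm_pow_mul_geometric_of_norm_lt_one (k + 1) hr
  have h' : Summable fun n : ℕ =>
      (ArithmeticFunction.sigma k n : ℝ) * Real.exp (-2 * Real.pi) ^ n := by
    refine Summable.of_norm_bounded h fun n => ?_
    simp only [norm_mul, Real.norm_natCast, norm_pow]
    gcongr
    exact_mod_cast ArithmeticFunction.sigma_le_pow_succ k n
  exact h'.comp_injective PNat.coe_injective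

theorem norm_divisorSeries_term_le (k : ℕ) (n : ℕ+) {y : ℝ} (hy : 1 ≤ y) :
    ‖(ArithmeticFunction.sigma k n : ℝ) * Real.exp (-2 * Real.pi * y) ^ (n : ℕ)‖ ≤
      (ArithmeticFunction.sigma k n : ℝ) * Real.exp (-2 * Real.pi) ^ (n : ℕ) := by
  rw [Real.norm_of_nonneg (by positivity)]
  have : -2 * Real.pi * y ≤ -2 * Real.pi := by nlinarith [Real.pi_pos]
  gcongr

theorem continuousOn_divisorSeries (k : ℕ) : ContinuousOn (divisorSeries k) (Set.Ici 1) :=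
  continuousOn_tsum (fun n => by fun_prop) (summable_divisorSeries k)
    fun n y hy => norm_divisorSeries_term_le k n hy

theorem tendsto_divisorSeries (k : ℕ) : Tendsto (divisorSeries k) atTop (𝓝 0) := by
  have h := tendsto_tsum_of_dominated_convergence (𝓕 := atTop)
    (f := fun (y : ℝ) (n : ℕ+) =>
      (ArithmeticFunction.sigma k n : ℝ) * Real.exp (-2 * Real.pi * y) ^ (n : ℕ))
    (g := fun _ => 0) (summable_divisorSeries k) ?_ ?_
  · rwa [tsum_zero] at h
  · intro n
    have h1 : Tendsto (fun y : ℝ => Real.exp (-2 * Real.pi * y)) atTop (𝓝 0) := by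
      refine Real.tendsto_exp_atBot.comp ?_
      exact tendsto_id.const_mul_atTop_of_neg (by nlinarith [Real.pi_pos])
    simpa using (h1.pow (n : ℕ)).const_mul (ArithmeticFunction.sigma k n : ℝ)
  · filter_upwards [eventually_ge_atTop 1] with y hy n
    exact norm_divisorSeries_term_le k n hy

theorem divisorSeries_nonneg (k : ℕ) (y : ℝ) : 0 ≤ divisorSeries k y :=
  tsum_nonneg fun n => by positivity

theorem linearIndependent_rectangular {c : ℂ} (hc : c ≠ 0) {y : ℝ} (hy : 0 < y) :
    LinearIndependent ℝ ![c, c * (y * Complex.I)] := by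
  rw [LinearIndependent.pair_iff]
  intro s t h
  have h1 : (s : ℂ) + t * (y * Complex.I) = 0 := by
    have h2 : c * ((s : ℂ) + t * (y * Complex.I)) = 0 := by
      simp only [Complex.real_smul] at h
      linear_combination h
    exact (mul_eq_zero.mp h2).resolve_left hc
  have hre := congrArg Complex.re h1
  have him := congrArg Complex.im h1
  simp at hre him
  exact ⟨hre, him.resolve_right hy.ne'⟩

/-- The lattice `c (ℤ + i y ℤ)`. -/
noncomputable def rectangularPair (c : ℂ) (hc : c ≠ 0) (y : ℝ) (hy : 0 < y) : PeriodPair where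
  ω₁ := c
  ω₂ := c * (y * Complex.I)
  indep := linearIndependent_rectangular hc hy

/-- The Eisenstein series of a rectangular lattice; all terms of its `q`-expansion are real. -/
theorem rectangularPair_G {c : ℂ} (hc : c ≠ 0) {y : ℝ} (hy : 0 < y) {k : ℕ} (hk : 3 ≤ k)
    (hk2 : Even k) :
    (rectangularPair c hc y hy).G k = (c ^ k)⁻¹ * (2 * riemannZeta k +
      2 * ((-2 * Real.pi * Complex.I) ^ k / (k - 1).factorial) * divisorSeries (k - 1) y) := by
  have h := tsum_eisSummand_eq_tsum_sigma_mul_cexp_pow hk hk2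
    ⟨(y : ℂ) * Complex.I, by simpa using hy⟩
  have hq : Complex.exp (2 * Real.pi * Complex.I * ((y : ℂ) * Complex.I)) =
      (Real.exp (-2 * Real.pi * y) : ℝ) := by
    push_cast
    congr 1
    linear_combination (2 * Real.pi * y) * Complex.I_sq
  simp only [hq] at h
  have hd : ((divisorSeries (k - 1) y : ℝ) : ℂ) = ∑' n : ℕ+,
      (ArithmeticFunction.sigma (k - 1) (n : ℕ) : ℂ) *
      ((Real.exp (-2 * Real.pi * y) : ℝ) : ℂ) ^ (n : ℕ) := by
    rw [divisorSeries, Complex.ofReal_tsum]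
    push_cast
    rfl
  rw [hd, ← h, ← tsum_mul_left, PeriodPair.G]
  rw [← (rectangularPair c hc y hy).latticeEquivProd.symm.toEquiv.tsum_eq,
    ← (Equiv.prodComm ℤ ℤ).tsum_eq, ← (finTwoArrowEquiv ℤ).tsum_eq]
  refine tsum_congr fun v => ?_
  have hl : (((rectangularPair c hc y hy).latticeEquivProd.symm (v 1, v 0) :
      (rectangularPair c hc y hy).lattice) : ℂ) = v 1 * c + v 0 * (c * (y * Complex.I)) :=
    PeriodPair.latticeEquiv_symm_apply _ _
  change (((((rectangularPair c hc y hy).latticeEquivProd.symm (v 1, v 0) :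
      (rectangularPair c hc y hy).lattice) : ℂ)) ^ k)⁻¹ = _
  rw [hl]
  simp only [EisensteinSeries.eisSummand, zpow_neg, zpow_natCast, ← mul_inv, ← mul_pow]
  congr 2
  ring

theorem rectangularPair_g₂ {c : ℂ} (hc : c ≠ 0) {y : ℝ} (hy : 0 < y) :
    (rectangularPair c hc y hy).g₂ =
      (c ^ 4)⁻¹ * ((4 * Real.pi ^ 4 / 3 * (1 + 240 * divisorSeries 3 y) : ℝ) : ℂ) := by
  have h := rectangularPair_G hc hy (k := 4) (by norm_num) (by decide)
  rw [PeriodPair.g₂, h]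
  have h4 : riemannZeta ((4 : ℕ) : ℂ) = Real.pi ^ 4 / 90 := by
    rw [← riemannZeta_four]; norm_num
  rw [h4]
  have hI : (-2 * (Real.pi : ℂ) * Complex.I) ^ 4 = 16 * Real.pi ^ 4 := by
    rw [mul_pow, Complex.I_pow_four]; ring
  rw [hI]
  norm_num [Nat.factorial]
  ring

theorem riemannZeta_six : riemannZeta 6 = (Real.pi : ℂ) ^ 6 / 945 := by
  have h := riemannZeta_two_mul_nat (k := 3) (by norm_num)
  have hb : bernoulli 6 = 1 / 42 := by
    rw [bernoulli_eq_bernoulli'_of_ne_one (by norm_num), bernoulli'_def]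
    norm_num [Finset.sum_range_succ, Nat.choose, bernoulli'_two, bernoulli'_four,
      bernoulli'_three, bernoulli'_eq_zero_of_odd (n := 5) (by decide) (by norm_num)]
  norm_num [Nat.factorial, hb] at h
  rw [h]; ring

theorem rectangularPair_g₃ {c : ℂ} (hc : c ≠ 0) {y : ℝ} (hy : 0 < y) :
    (rectangularPair c hc y hy).g₃ =
      (c ^ 6)⁻¹ * ((8 * Real.pi ^ 6 / 27 * (1 - 504 * divisorSeries 5 y) : ℝ) : ℂ) := by
  have h := rectangularPair_G hc hy (k := 6) (by norm_num) (by decide)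
  rw [PeriodPair.g₃, h]
  have h4 : riemannZeta ((6 : ℕ) : ℂ) = Real.pi ^ 6 / 945 := by
    rw [← riemannZeta_six]; norm_num
  rw [h4]
  have hI : (-2 * (Real.pi : ℂ) * Complex.I) ^ 6 = -64 * Real.pi ^ 6 := by
    rw [mul_pow, show (6 : ℕ) = 4 + 2 from rfl, pow_add Complex.I, Complex.I_pow_four,
      Complex.I_sq]; ring
  rw [hI]
  norm_num [Nat.factorial]
  ring

/-- The square lattice `ℤ + iℤ` is invariant under multiplication by `i`, hence its `g₃` is zero. -/
theorem divisorSeries_five_one : 1 - 504 * divisorSeries 5 1 = 0 := by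
  set Λ := rectangularPair 1 one_ne_zero 1 one_pos with hΛ
  have hmem : ∀ z, z ∈ Λ.lattice → Complex.I * z ∈ Λ.lattice := by
    intro z hz
    obtain ⟨m, n, rfl⟩ := PeriodPair.mem_lattice.mp hz
    refine PeriodPair.mem_lattice.mpr ⟨-n, m, ?_⟩
    simp only [hΛ, rectangularPair]
    push_cast
    linear_combination (-n : ℂ) * Complex.I_sq
  -- multiplication by `i` as a permutation of the lattice
  let e : Λ.lattice ≃ Λ.lattice :=
    { toFun := fun l => ⟨Complex.I * l, hmem l l.2⟩
      invFun := fun l => ⟨-(Complex.I * l), neg_mem (hmem l l.2)⟩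
      left_inv := fun l => by
        ext; simp only; linear_combination (-(l : ℂ)) * Complex.I_sq
      right_inv := fun l => by
        ext; simp only; linear_combination (-(l : ℂ)) * Complex.I_sq }
  have hG : Λ.G 6 = -Λ.G 6 := by
    conv_lhs => rw [PeriodPair.G, ← e.tsum_eq]
    rw [PeriodPair.G, ← tsum_neg]
    refine tsum_congr fun l => ?_
    change ((Complex.I * (l : ℂ)) ^ 6)⁻¹ = _
    rw [mul_pow, show (6 : ℕ) = 4 + 2 from rfl, pow_add Complex.I, Complex.I_pow_four,
      Complex.I_sq, ← inv_neg]
    ring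
  have h0 : Λ.g₃ = 0 := by
    rw [PeriodPair.g₃, self_eq_neg.mp hG, mul_zero]
  rw [hΛ, rectangularPair_g₃] at h0
  simp only [one_pow, inv_one, one_mul] at h0
  have h1 := Complex.ofReal_eq_zero.mp h0
  exact (mul_eq_zero.mp h1).resolve_left (by positivity)

/-- Real invariants with positive discriminant belong to a rectangular lattice. The shape of the
rectangle comes from the intermediate value theorem between the square, where `g₃ = 0`, and the
infinitely long rectangle, where the discriminant vanishes. -/
theorem exists_periodPair_of_discriminant_pos {a b : ℝ} (h : 27 * b ^ 2 < a ^ 3) :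
    ∃ Λ : PeriodPair, Λ.g₂ = a ∧ Λ.g₃ = b := by
  have ha3 : 0 < a ^ 3 := lt_of_le_of_lt (by positivity) h
  have ha : 0 < a := by
    by_contra hn
    have h1 : a ^ 3 ≤ 0 := Odd.pow_nonpos (by decide) (not_lt.mp hn)
    linarith
  set P : ℝ → ℝ := fun y => 4 * Real.pi ^ 4 / 3 * (1 + 240 * divisorSeries 3 y) with hP
  set R : ℝ → ℝ := fun y => 8 * Real.pi ^ 6 / 27 * (1 - 504 * divisorSeries 5 y) with hR
  have hPpos : ∀ y, 0 < P y := fun y => by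
    have := divisorSeries_nonneg 3 y
    simp only [hP]; positivity
  set F : ℝ → ℝ := fun y => R y ^ 2 * a ^ 3 - b ^ 2 * P y ^ 3 with hF
  have hFc : ContinuousOn F (Set.Ici 1) := by
    have h3 := continuousOn_divisorSeries 3
    have h5 := continuousOn_divisorSeries 5
    simp only [hF, hP, hR]
    fun_prop
  have hF1 : F 1 ≤ 0 := by
    have hR1 : R 1 = 0 := by simp only [hR, divisorSeries_five_one, mul_zero]
    have := (hPpos 1).le
    simp only [hF, hR1]
    have : 0 ≤ b ^ 2 * P 1 ^ 3 := by positivity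
    linarith
  have hlim : Tendsto F atTop (𝓝 ((8 * Real.pi ^ 6 / 27 * (1 - 504 * 0)) ^ 2 * a ^ 3 -
      b ^ 2 * (4 * Real.pi ^ 4 / 3 * (1 + 240 * 0)) ^ 3)) := by
    have h3 := tendsto_divisorSeries 3
    have h5 := tendsto_divisorSeries 5
    exact (((((h5.const_mul 504).const_sub 1).const_mul _).pow 2).mul_const _).sub
      (((((h3.const_mul 240).const_add 1).const_mul _).pow 3).const_mul _)
  have hpos : 0 < (8 * Real.pi ^ 6 / 27 * (1 - 504 * 0)) ^ 2 * a ^ 3 -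
      b ^ 2 * (4 * Real.pi ^ 4 / 3 * (1 + 240 * 0)) ^ 3 := by
    have : (8 * Real.pi ^ 6 / 27 * (1 - 504 * 0)) ^ 2 * a ^ 3 -
      b ^ 2 * (4 * Real.pi ^ 4 / 3 * (1 + 240 * 0)) ^ 3 =
      64 * Real.pi ^ 12 / 729 * (a ^ 3 - 27 * b ^ 2) := by ring
    rw [this]
    have := Real.pi_pos
    have : 0 < a ^ 3 - 27 * b ^ 2 := by linarith
    positivity
  obtain ⟨Y, hY1, hY⟩ := ((eventually_ge_atTop (1 : ℝ)).and (hlim.eventually (lt_mem_nhds hpos))).exists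
  obtain ⟨y, ⟨hy1, -⟩, hy⟩ := intermediate_value_Icc hY1
    (hFc.mono Set.Icc_subset_Ici_self) ⟨hF1, hY.le⟩
  have hy0 : 0 < y := by linarith
  obtain ⟨ν, hν, hν4⟩ : ∃ ν : ℝ, 0 < ν ∧ ν ^ 4 = P y / a := by
    refine ⟨(P y / a) ^ ((4 : ℕ) : ℝ)⁻¹, ?_, ?_⟩
    · have := hPpos y; positivity
    · exact Real.rpow_inv_natCast_pow (div_pos (hPpos y) ha).le (by norm_num)
  have hP' : P y = a * ν ^ 4 := by rw [hν4]; field_simp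
  have hsq : (R y) ^ 2 = (b * ν ^ 6) ^ 2 := by
    have h1 : R y ^ 2 * a ^ 3 - b ^ 2 * P y ^ 3 = 0 := hy
    rw [hP'] at h1
    have h2 : a ^ 3 * (R y ^ 2 - (b * ν ^ 6) ^ 2) = 0 := by linear_combination h1
    exact sub_eq_zero.mp ((mul_eq_zero.mp h2).resolve_left ha3.ne')
  have hνc : (ν : ℂ) ≠ 0 := Complex.ofReal_ne_zero.mpr hν.ne'
  rcases sq_eq_sq_iff_eq_or_eq_neg.mp hsq with hR' | hR'
  · refine ⟨rectangularPair ν hνc y hy0, ?_, ?_⟩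
    · rw [rectangularPair_g₂]
      change _ * ((P y : ℝ) : ℂ) = _
      rw [hP']; push_cast; field_simp
    · rw [rectangularPair_g₃]
      change _ * ((R y : ℝ) : ℂ) = _
      rw [hR']; push_cast; field_simp
  -- a quarter turn of the lattice changes the sign of `g₃` and keeps `g₂`
  · have hi6 : (Complex.I) ^ 6 = -1 := by
      rw [show (6 : ℕ) = 4 + 2 from rfl, pow_add, Complex.I_pow_four, Complex.I_sq]; ring
    refine ⟨rectangularPair (Complex.I * ν) (mul_ne_zero Complex.I_ne_zero hνc) y hy0, ?_, ?_⟩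
    · rw [rectangularPair_g₂]
      change _ * ((P y : ℝ) : ℂ) = _
      rw [hP', mul_pow, Complex.I_pow_four]; push_cast; field_simp
    · rw [rectangularPair_g₃]
      change _ * ((R y : ℝ) : ℂ) = _
      rw [hR', mul_pow, hi6]; push_cast; field_simp

end RectangularLattices

/-! ### The reciprocal of a shifted Weierstrass function -/

namespace PeriodPair

section ReciprocalOfWeierstrassP

open Filter Topology

variable (Λ : PeriodPair)

theorem isPreconnected_compl_lattice : IsPreconnected ((Λ.lattice : Set ℂ)ᶜ) := by
  have hc : (Λ.lattice : Set ℂ).Countable :=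
    Set.countable_coe_iff.mp (inferInstanceAs (Countable Λ.lattice))
  refine (hc.isPathConnected_compl_of_one_lt_rank ?_).isConnected.isPreconnected
  rw [Complex.rank_real_complex]
  exact Cardinal.one_lt_two

theorem isOpen_compl_lattice : IsOpen ((Λ.lattice : Set ℂ)ᶜ) := Λ.isClosed_lattice.isOpen_compl

/-- Close to the origin `℘'(z) = -2 / z³ + O(z)`, which is not zero. -/
theorem exists_derivWeierstrassP_ne_zero : ∃ z ∉ Λ.lattice, Λ.derivWeierstrassP z ≠ 0 := by
  by_contra! h
  have hc : ContinuousAt (Λ.derivWeierstrassPExcept 0) 0 :=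
    (Λ.analyticAt_derivWeierstrassPExcept 0).continuousAt
  have h1 : Tendsto (fun z : ℂ => z ^ 3 * Λ.derivWeierstrassPExcept 0 z) (𝓝[≠] 0) (𝓝 0) := by
    have : ContinuousAt (fun z : ℂ => z ^ 3 * Λ.derivWeierstrassPExcept 0 z) 0 := by fun_prop
    have h2 := this.tendsto
    simp only [ne_eq, OfNat.ofNat_ne_zero, not_false_eq_true, zero_pow, zero_mul] at h2
    exact h2.mono_left nhdsWithin_le_nhds
  have h2 : ∀ᶠ z in 𝓝[≠] (0 : ℂ), z ^ 3 * Λ.derivWeierstrassPExcept 0 z = 2 := by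
    filter_upwards [nhdsWithin_le_nhds (Λ.compl_lattice_sdiff_singleton_mem_nhds 0),
      self_mem_nhdsWithin] with z hz hz0
    have hz0' : z ≠ 0 := hz0
    have hzΛ : z ∉ Λ.lattice := fun hm => hz ⟨hm, hz0⟩
    have h3 := Λ.derivWeierstrassPExcept_def 0 z
    simp only [ZeroMemClass.coe_zero, sub_zero, h z hzΛ, zero_add] at h3
    rw [h3]; field_simp
  have h3 : Tendsto (fun z : ℂ => z ^ 3 * Λ.derivWeierstrassPExcept 0 z) (𝓝[≠] 0) (𝓝 2) :=
    tendsto_const_nhds.congr' (h2.mono fun _ hz => hz.symm)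
  exact two_ne_zero (tendsto_nhds_unique h3 h1)

theorem hasDerivAt_weierstrassP {z : ℂ} (hz : z ∉ Λ.lattice) :
    HasDerivAt Λ.weierstrassP (Λ.derivWeierstrassP z) z := by
  have h := (Λ.analyticOnNhd_weierstrassP z hz).differentiableAt.hasDerivAt
  rwa [Λ.deriv_weierstrassP] at h

/-- The second-order differential equation of `℘`, obtained from the first-order one by
differentiation and division by `℘'`. -/
theorem hasDerivAt_derivWeierstrassP {z : ℂ} (hz : z ∉ Λ.lattice) :
    HasDerivAt Λ.derivWeierstrassP (6 * Λ.weierstrassP z ^ 2 - Λ.g₂ / 2) z := by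
  have hana := Λ.analyticOnNhd_derivWeierstrassP
  have hanaP := Λ.analyticOnNhd_weierstrassP
  have hmul : ∀ z ∈ ((Λ.lattice : Set ℂ)ᶜ), Λ.derivWeierstrassP z *
      (deriv Λ.derivWeierstrassP z - (6 * Λ.weierstrassP z ^ 2 - Λ.g₂ / 2)) = 0 := by
    intro w hw
    have h1 := ((hana w hw).differentiableAt.hasDerivAt).pow 2
    have hP := Λ.hasDerivAt_weierstrassP hw
    have h2 := (((hP.pow 3).const_mul 4).sub (hP.const_mul Λ.g₂)).sub_const Λ.g₃
    have heq : (Λ.derivWeierstrassP ^ 2) =ᶠ[𝓝 w]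
        fun z => 4 * (Λ.weierstrassP ^ 3) z - Λ.g₂ * Λ.weierstrassP z - Λ.g₃ := by
      filter_upwards [Λ.isOpen_compl_lattice.mem_nhds hw] with v hv
      exact Λ.derivWeierstrassP_sq v hv
    have h3 := (h2.congr_of_eventuallyEq heq).unique h1
    simp only [Nat.cast_ofNat, Nat.add_one_sub_one, pow_one] at h3
    linear_combination (-1 / 2) * h3
  have hcase := AnalyticOnNhd.eq_zero_or_eq_zero_of_mul_eq_zero hana
    (hana.deriv.sub ((analyticOnNhd_const.mul (hanaP.pow 2)).sub analyticOnNhd_const)) hmul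
    Λ.isPreconnected_compl_lattice
  rcases hcase with h0 | h0
  · obtain ⟨w, hw, hne⟩ := Λ.exists_derivWeierstrassP_ne_zero
    exact absurd (h0 w hw) hne
  · have h1 := (hana z hz).differentiableAt.hasDerivAt
    have h2 := h0 z hz
    simp only [Pi.sub_apply] at h2
    rwa [sub_eq_zero.mp h2] at h1

open Classical in
/-- The function `1 / (℘ + b)`, continued by its value `0` to the poles of `℘`. -/
noncomputable def recipWeierstrassP (b z : ℂ) : ℂ :=
  if z ∈ Λ.lattice then 0 else (Λ.weierstrassP z + b)⁻¹

/-- The points where `1 / (℘ + b)` has no pole. -/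
def recipRegular (b : ℂ) : Set ℂ := {z | z ∈ Λ.lattice ∨ Λ.weierstrassP z + b ≠ 0}

variable {Λ} {b z : ℂ}

theorem recipWeierstrassP_of_mem (hz : z ∈ Λ.lattice) : Λ.recipWeierstrassP b z = 0 := by
  simp [recipWeierstrassP, hz]

theorem recipWeierstrassP_of_notMem (hz : z ∉ Λ.lattice) :
    Λ.recipWeierstrassP b z = (Λ.weierstrassP z + b)⁻¹ := by
  simp [recipWeierstrassP, hz]

theorem recipWeierstrassP_neg (b z : ℂ) :
    Λ.recipWeierstrassP b (-z) = Λ.recipWeierstrassP b z := by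
  have h : -z ∈ Λ.lattice ↔ z ∈ Λ.lattice := neg_mem_iff
  by_cases hz : z ∈ Λ.lattice
  · rw [recipWeierstrassP_of_mem hz, recipWeierstrassP_of_mem (h.mpr hz)]
  · rw [recipWeierstrassP_of_notMem hz, recipWeierstrassP_of_notMem (hz ∘ h.mp),
      Λ.weierstrassP_neg]

theorem neg_mem_recipRegular : -z ∈ Λ.recipRegular b ↔ z ∈ Λ.recipRegular b := by
  simp [recipRegular]

theorem recipWeierstrassP_eventuallyEq (hz : z ∉ Λ.lattice) :
    Λ.recipWeierstrassP b =ᶠ[𝓝 z] fun w => (Λ.weierstrassP w + b)⁻¹ := by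
  filter_upwards [Λ.isOpen_compl_lattice.mem_nhds hz] with w hw
  exact recipWeierstrassP_of_notMem hw

/-- At a lattice point `l`, `1 / (℘ + b)` is the quotient of `(z - l)²` by a function with
value `1` at `l`. -/
theorem analyticAt_recipWeierstrassP (hz : z ∈ Λ.recipRegular b) :
    AnalyticAt ℂ (Λ.recipWeierstrassP b) z := by
  by_cases hm : z ∈ Λ.lattice
  · have hE := Λ.analyticAt_weierstrassPExcept z
    have hden : AnalyticAt ℂ
        (fun w => 1 + (w - z) ^ 2 * (Λ.weierstrassPExcept z w - 1 / z ^ 2 + b)) z := by fun_prop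
    have hA : AnalyticAt ℂ (fun w => (w - z) ^ 2 /
        (1 + (w - z) ^ 2 * (Λ.weierstrassPExcept z w - 1 / z ^ 2 + b))) z :=
      AnalyticAt.div (by fun_prop) hden (by simp)
    refine hA.congr ?_
    filter_upwards [Λ.compl_lattice_sdiff_singleton_mem_nhds z] with w hw
    by_cases hwz : w = z
    · subst hwz
      simp [recipWeierstrassP_of_mem hm]
    · have hwm : w ∉ Λ.lattice := fun h => hw ⟨h, hwz⟩
      have hs : w - z ≠ 0 := sub_ne_zero.mpr hwz
      rw [recipWeierstrassP_of_notMem hwm, ← Λ.weierstrassPExcept_add ⟨z, hm⟩ w]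
      have : Λ.weierstrassPExcept z w + (1 / (w - z) ^ 2 - 1 / z ^ 2) + b =
          (1 + (w - z) ^ 2 * (Λ.weierstrassPExcept z w - 1 / z ^ 2 + b)) / (w - z) ^ 2 := by
        generalize 1 / z ^ 2 = s
        field_simp
        ring
      simp only [this, inv_div]
  · have hne := hz.resolve_left hm
    refine AnalyticAt.congr ?_ (recipWeierstrassP_eventuallyEq hm).symm
    exact ((Λ.analyticOnNhd_weierstrassP z hm).add analyticAt_const).inv hne

theorem isOpen_recipRegular (Λ : PeriodPair) (b : ℂ) : IsOpen (Λ.recipRegular b) := by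
  rw [isOpen_iff_mem_nhds]
  intro z hz
  by_cases hm : z ∈ Λ.lattice
  -- near a lattice point `z` the function `(w - z)² (℘(w) + b)` is continuous with value `1` at `z`
  · have hE := (Λ.analyticAt_weierstrassPExcept z).continuousAt
    have hc : ContinuousAt
        (fun w => 1 + (w - z) ^ 2 * (Λ.weierstrassPExcept z w - 1 / z ^ 2 + b)) z := by fun_prop
    have hne := hc.eventually_ne (y := 0) (by simp)
    filter_upwards [Λ.compl_lattice_sdiff_singleton_mem_nhds z, hne] with w hw hw1
    by_cases hwz : w = z
    · subst hwz; exact hz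
    · right
      have hs : w - z ≠ 0 := sub_ne_zero.mpr hwz
      rw [← Λ.weierstrassPExcept_add ⟨z, hm⟩ w]
      intro h0
      apply hw1
      have : Λ.weierstrassPExcept z w - 1 / z ^ 2 + b = -(1 / (w - z) ^ 2) := by
        linear_combination h0
      rw [this]; field_simp; ring
  · have hne := hz.resolve_left hm
    have hc : ContinuousAt (fun w => Λ.weierstrassP w + b) z :=
      (Λ.analyticOnNhd_weierstrassP z hm).continuousAt.add continuousAt_const
    filter_upwards [hc.eventually_ne hne] with w hw using Or.inr hw

theorem deriv_recipWeierstrassP_of_notMem (hz : z ∉ Λ.lattice) (hne : Λ.weierstrassP z + b ≠ 0) :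
    deriv (Λ.recipWeierstrassP b) z =
      -Λ.derivWeierstrassP z * Λ.recipWeierstrassP b z ^ 2 := by
  have h := (((Λ.hasDerivAt_weierstrassP hz).add_const b).fun_inv hne).congr_of_eventuallyEq
    (recipWeierstrassP_eventuallyEq hz)
  rw [h.deriv, recipWeierstrassP_of_notMem hz]
  field_simp

/-- The second derivative of `y = 1 / (℘ + b)` as a polynomial in `y`. -/
noncomputable def recipForce (Λ : PeriodPair) (b y : ℂ) : ℂ :=
  2 - 12 * b * y + 3 / 2 * (12 * b ^ 2 - Λ.g₂) * y ^ 2 +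
    2 * (-4 * b ^ 3 + Λ.g₂ * b - Λ.g₃) * y ^ 3

/-- The function `y = 1 / (℘ + b)` solves a differential equation that is regular at the poles of
`℘`. -/
theorem hasDerivAt_deriv_recipWeierstrassP (hz : z ∈ Λ.recipRegular b) :
    HasDerivAt (deriv (Λ.recipWeierstrassP b))
      (Λ.recipForce b (Λ.recipWeierstrassP b z)) z := by
  have key : ∀ w ∉ Λ.lattice, Λ.weierstrassP w + b ≠ 0 →
      deriv (deriv (Λ.recipWeierstrassP b)) w = Λ.recipForce b (Λ.recipWeierstrassP b w) := by
    intro w hw hne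
    have hwr : w ∈ Λ.recipRegular b := Or.inr hne
    have hev : deriv (Λ.recipWeierstrassP b) =ᶠ[𝓝 w]
        fun v => -Λ.derivWeierstrassP v * Λ.recipWeierstrassP b v ^ 2 := by
      filter_upwards [Λ.isOpen_compl_lattice.mem_nhds hw,
        (((Λ.analyticOnNhd_weierstrassP w hw).continuousAt.add
          continuousAt_const).eventually_ne hne)] with v hv hv'
      exact deriv_recipWeierstrassP_of_notMem hv hv'
    have hy := (analyticAt_recipWeierstrassP hwr).differentiableAt.hasDerivAt
    have h2 := ((Λ.hasDerivAt_derivWeierstrassP hw).neg.mul (hy.pow 2)).congr_of_eventuallyEq hev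
    rw [h2.deriv, deriv_recipWeierstrassP_of_notMem hw hne]
    have hsq := Λ.derivWeierstrassP_sq w hw
    have hyP : Λ.recipWeierstrassP b w * (Λ.weierstrassP w + b) = 1 := by
      rw [recipWeierstrassP_of_notMem hw, inv_mul_cancel₀ hne]
    simp only [recipForce, Pi.neg_apply, Pi.pow_apply]
    generalize Λ.recipWeierstrassP b w = y at *
    generalize Λ.derivWeierstrassP w = p' at *
    have hy0 : y ≠ 0 := by rintro rfl; simp at hyP
    have hp : Λ.weierstrassP w = 1 / y - b := by
      field_simp; linear_combination hyP
    rw [hp] at hsq ⊢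
    have e1 : -(6 * (1 / y - b) ^ 2 - Λ.g₂ / 2) * y ^ 2 + 2 * p' ^ 2 * y ^ 3 =
        2 - 12 * b * y + 3 / 2 * (12 * b ^ 2 - Λ.g₂) * y ^ 2 +
          2 * (-4 * b ^ 3 + Λ.g₂ * b - Λ.g₃) * y ^ 3 := by
      rw [hsq]
      field_simp
      ring
    rw [← e1]
    push_cast
    ring
  have hana := analyticAt_recipWeierstrassP hz
  have heq : deriv (deriv (Λ.recipWeierstrassP b)) z =
      Λ.recipForce b (Λ.recipWeierstrassP b z) := by
    have hc1 : ContinuousAt (deriv (deriv (Λ.recipWeierstrassP b))) z :=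
      hana.deriv.deriv.continuousAt
    have hc2 : ContinuousAt (fun w => Λ.recipForce b (Λ.recipWeierstrassP b w)) z := by
      have := hana.continuousAt
      unfold recipForce
      fun_prop
    have hev : deriv (deriv (Λ.recipWeierstrassP b)) =ᶠ[𝓝[≠] z]
        fun w => Λ.recipForce b (Λ.recipWeierstrassP b w) := by
      filter_upwards [nhdsWithin_le_nhds (Λ.compl_lattice_sdiff_singleton_mem_nhds z),
        nhdsWithin_le_nhds ((isOpen_recipRegular Λ b).mem_nhds hz), self_mem_nhdsWithin]
        with w hw hwr hwz
      have hwm : w ∉ Λ.lattice := fun h => hw ⟨h, hwz⟩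
      exact key w hwm (hwr.resolve_left hwm)
    exact tendsto_nhds_unique (hc1.tendsto.mono_left nhdsWithin_le_nhds)
      ((hc2.tendsto.mono_left nhdsWithin_le_nhds).congr' (hev.mono fun _ h => h.symm))
  rw [← heq]
  exact hana.deriv.differentiableAt.hasDerivAt

theorem zero_mem_recipRegular (Λ : PeriodPair) (b : ℂ) : (0 : ℂ) ∈ Λ.recipRegular b :=
  Or.inl (zero_mem _)

theorem recipWeierstrassP_zero (Λ : PeriodPair) (b : ℂ) : Λ.recipWeierstrassP b 0 = 0 :=
  recipWeierstrassP_of_mem (zero_mem _)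

theorem deriv_recipWeierstrassP_zero (Λ : PeriodPair) (b : ℂ) :
    deriv (Λ.recipWeierstrassP b) 0 = 0 := by
  have h := deriv_comp_neg (Λ.recipWeierstrassP b) (0 : ℂ)
  simp only [recipWeierstrassP_neg, neg_zero] at h
  exact self_eq_neg.mp h

end ReciprocalOfWeierstrassP

end PeriodPair

/-! ### Grönwall estimates and the absence of poles -/

section Gronwall

open Filter Topology Set

/-- A property that spreads from `[0, x)` to a neighbourhood of `x` holds on the whole interval. -/
theorem forall_mem_Icc_of_spread {Good : ℝ → Prop} {A : ℝ}
    (h : ∀ x ∈ Icc 0 A, (∀ s ∈ Ico 0 x, Good s) → ∀ᶠ s in 𝓝 x, Good s) :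
    ∀ x ∈ Icc 0 A, Good x := by
  by_contra! hcon
  obtain ⟨x, hx, hbad⟩ := hcon
  set S : Set ℝ := {s | s ∈ Icc 0 A ∧ ¬ Good s} with hS
  have hne : S.Nonempty := ⟨x, hx, hbad⟩
  have hbd : BddBelow S := ⟨0, fun s hs => hs.1.1⟩
  have h0 : 0 ≤ sInf S := le_csInf hne fun s hs => hs.1.1
  have hA : sInf S ≤ A := (csInf_le hbd ⟨hx, hbad⟩).trans hx.2
  have hgood : ∀ s ∈ Ico 0 (sInf S), Good s := by
    intro s hs
    by_contra hn
    exact notMem_of_lt_csInf hs.2 hbd ⟨⟨hs.1, hs.2.le.trans hA⟩, hn⟩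
  obtain ⟨ε, hε, hball⟩ := Metric.eventually_nhds_iff.mp (h _ ⟨h0, hA⟩ hgood)
  obtain ⟨s, hs, hlt⟩ := exists_lt_of_csInf_lt hne (lt_add_of_pos_right (sInf S) hε)
  refine hs.2 (hball ?_)
  rw [Real.dist_eq, abs_of_nonneg (sub_nonneg.mpr (csInf_le hbd hs))]
  linarith

variable {F : Type*} [NormedAddCommGroup F] [NormedSpace ℝ F]

theorem gronwallBound_le {δ K ε T : ℝ} (hK : 1 ≤ K) (hε : 0 ≤ ε) :
    gronwallBound δ K ε T ≤ (δ + ε) * Real.exp (K * T) := by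
  have hK0 : K ≠ 0 := by positivity
  rw [gronwallBound_of_K_ne_0 hK0]
  have h1 : ε / K ≤ ε := div_le_self hε hK
  have h2 : 0 ≤ ε / K := by positivity
  have h3 := Real.exp_pos (K * T)
  nlinarith

theorem norm_le_of_norm_deriv_le_right {f f' : ℝ → F} {δ K ε a T : ℝ} (hK : 1 ≤ K) (hε : 0 ≤ ε)
    (hf : ∀ t ∈ Icc a (a + T), HasDerivAt f (f' t) t) (h0 : ‖f a‖ ≤ δ)
    (bound : ∀ t ∈ Icc a (a + T), ‖f' t‖ ≤ K * ‖f t‖ + ε) :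
    ∀ t ∈ Icc a (a + T), ‖f t‖ ≤ (δ + ε) * Real.exp (K * T) := by
  intro t ht
  have h := norm_le_gronwallBound_of_norm_deriv_right_le
    (fun s hs => (hf s hs).continuousAt.continuousWithinAt)
    (fun s hs => (hf s (Ico_subset_Icc_self hs)).hasDerivWithinAt) h0
    (fun s hs => bound s (Ico_subset_Icc_self hs)) t ht
  have hδ : 0 ≤ δ := (norm_nonneg _).trans h0
  refine (h.trans (gronwallBound_le hK hε)).trans ?_
  have : t - a ≤ T := by linarith [ht.2]
  gcongr

/-- Two-sided Grönwall inequality. -/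
theorem norm_le_of_norm_deriv_le {f f' : ℝ → F} {δ K ε a T : ℝ} (hK : 1 ≤ K) (hε : 0 ≤ ε)
    (hf : ∀ t, |t - a| ≤ T → HasDerivAt f (f' t) t) (h0 : ‖f a‖ ≤ δ)
    (bound : ∀ t, |t - a| ≤ T → ‖f' t‖ ≤ K * ‖f t‖ + ε) :
    ∀ t, |t - a| ≤ T → ‖f t‖ ≤ (δ + ε) * Real.exp (K * T) := by
  intro t ht
  rcases le_total a t with hat | hat
  · have hin : ∀ s ∈ Icc a (a + T), |s - a| ≤ T := fun s hs => by
      rw [abs_le]; constructor <;> linarith [hs.1, hs.2]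
    exact norm_le_of_norm_deriv_le_right hK hε (fun s hs => hf s (hin s hs)) h0
      (fun s hs => bound s (hin s hs)) t ⟨hat, by linarith [(abs_le.mp ht).2]⟩
  · have hin : ∀ s ∈ Icc (-a) (-a + T), |-s - a| ≤ T := fun s hs => by
      rw [abs_le]; constructor <;> linarith [hs.1, hs.2]
    have h := norm_le_of_norm_deriv_le_right (f := fun s => f (-s)) (f' := fun s => -f' (-s))
      (a := -a) (T := T) (δ := δ) hK hε
      (fun s hs => by
        have := (hf (-s) (hin s hs)).scomp s (hasDerivAt_neg s)
        simpa [Function.comp_def] using this)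
      (by simpa using h0)
      (fun s hs => by simpa using bound (-s) (hin s hs)) (-t)
      ⟨by linarith, by linarith [(abs_le.mp ht).1]⟩
    simpa using h

end Gronwall

namespace PeriodPair

open Filter Topology Set

variable {Λ : PeriodPair} {b : ℂ} {σ : ℝ}

theorem hasDerivAt_recipWeierstrassP_real {ψ : ℝ} (h : ((σ * ψ : ℝ) : ℂ) ∈ Λ.recipRegular b) :
    HasDerivAt (fun x : ℝ => Λ.recipWeierstrassP b ((σ * x : ℝ) : ℂ))
      (σ * deriv (Λ.recipWeierstrassP b) ((σ * ψ : ℝ) : ℂ)) ψ := by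
  have h1 := (analyticAt_recipWeierstrassP h).differentiableAt.hasDerivAt
  have h2 : HasDerivAt (fun x : ℝ => ((σ * x : ℝ) : ℂ)) (σ : ℂ) ψ := by
    simpa using ((hasDerivAt_id ψ).const_mul σ).ofReal_comp
  have h3 := h1.comp ψ h2
  rwa [mul_comm] at h3

theorem hasDerivAt_deriv_recipWeierstrassP_real {ψ : ℝ}
    (h : ((σ * ψ : ℝ) : ℂ) ∈ Λ.recipRegular b) :
    HasDerivAt (fun x : ℝ => σ * deriv (Λ.recipWeierstrassP b) ((σ * x : ℝ) : ℂ))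
      (σ ^ 2 * Λ.recipForce b (Λ.recipWeierstrassP b ((σ * ψ : ℝ) : ℂ))) ψ := by
  have h1 := hasDerivAt_deriv_recipWeierstrassP h
  have h2 : HasDerivAt (fun x : ℝ => ((σ * x : ℝ) : ℂ)) (σ : ℂ) ψ := by
    simpa using ((hasDerivAt_id ψ).const_mul σ).ofReal_comp
  have h3 := (h1.comp ψ h2).const_mul (σ : ℂ)
  rw [show (σ : ℂ) ^ 2 * Λ.recipForce b (Λ.recipWeierstrassP b ((σ * ψ : ℝ) : ℂ)) =
    σ * (Λ.recipForce b (Λ.recipWeierstrassP b ((σ * ψ : ℝ) : ℂ)) * σ) by ring]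
  exact h3

/-- If the force is bounded by `‖y‖ + C` on the ball of radius `B`, and `B` exceeds the Grönwall
bound, then `y = 1 / (℘ + b)` has no pole on the segment and stays in the ball. -/
theorem recipWeierstrassP_regular_and_bounded {A B C : ℝ} (hC : 0 ≤ C)
    (hforce : ∀ y : ℂ, ‖y‖ ≤ B → ‖(σ : ℂ) ^ 2 * Λ.recipForce b y‖ ≤ ‖y‖ + C)
    (hB : C * Real.exp A < B) :
    ∀ ψ : ℝ, |ψ| ≤ A → ((σ * ψ : ℝ) : ℂ) ∈ Λ.recipRegular b ∧
      ‖Λ.recipWeierstrassP b ((σ * ψ : ℝ) : ℂ)‖ < B := by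
  set Y : ℝ → ℂ := fun x => Λ.recipWeierstrassP b ((σ * x : ℝ) : ℂ) with hY
  set Y₁ : ℝ → ℂ := fun x => σ * deriv (Λ.recipWeierstrassP b) ((σ * x : ℝ) : ℂ) with hY₁
  have hBpos : 0 < B := lt_of_le_of_lt (by positivity) hB
  have hcont : Continuous fun x : ℝ => ((σ * x : ℝ) : ℂ) := by fun_prop
  have main : ∀ x ∈ Icc 0 A, ((σ * x : ℝ) : ℂ) ∈ Λ.recipRegular b ∧ ‖Y x‖ < B := by
    refine forall_mem_Icc_of_spread fun x hx hgood => ?_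
    -- the Grönwall bound on `[0, x)` is strictly better than the bound `B` assumed there
    have hle : ∀ s ∈ Ico 0 x, ‖Y s‖ ≤ C * Real.exp A := by
      intro s hs
      have hg : ∀ r ∈ Icc (0 : ℝ) (0 + s), ((σ * r : ℝ) : ℂ) ∈ Λ.recipRegular b ∧ ‖Y r‖ < B :=
        fun r hr => hgood r ⟨hr.1, by linarith [hr.2, hs.2]⟩
      have h := norm_le_of_norm_deriv_le_right (f := fun r => (Y r, Y₁ r))
        (f' := fun r => (Y₁ r, (σ : ℂ) ^ 2 * Λ.recipForce b (Y r)))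
        (δ := 0) (K := 1) (ε := C) (a := 0) (T := s) le_rfl hC
        (fun r hr => (hasDerivAt_recipWeierstrassP_real (hg r hr).1).prodMk
          (hasDerivAt_deriv_recipWeierstrassP_real (hg r hr).1))
        (by simp [hY, hY₁, recipWeierstrassP_zero, deriv_recipWeierstrassP_zero])
        (fun r hr => by
          have h1 := hforce (Y r) (hg r hr).2.le
          simp only [Prod.norm_def]
          have h2 := le_max_left ‖Y r‖ ‖Y₁ r‖
          have h3 := le_max_right ‖Y r‖ ‖Y₁ r‖
          apply max_le <;> linarith) s ⟨hs.1, by linarith⟩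
      have h4 : ‖Y s‖ ≤ ‖(Y s, Y₁ s)‖ := norm_fst_le (Y s, Y₁ s)
      refine h4.trans (h.trans ?_)
      rw [zero_add, one_mul]
      have := hs.2.le.trans hx.2
      gcongr
    -- a pole at `x` would make `y` unbounded to the left of `x`
    have hreg : ((σ * x : ℝ) : ℂ) ∈ Λ.recipRegular b := by
      rcases hx.1.eq_or_lt with h0 | h0
      · rw [← h0]; simpa using zero_mem_recipRegular Λ b
      · by_contra hn
        have hm : ((σ * x : ℝ) : ℂ) ∉ Λ.lattice := fun h => hn (Or.inl h)
        have hz : Λ.weierstrassP ((σ * x : ℝ) : ℂ) + b = 0 := by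
          by_contra h; exact hn (Or.inr h)
        have hc : ContinuousAt (fun s : ℝ => ‖Λ.weierstrassP ((σ * s : ℝ) : ℂ) + b‖) x := by
          have h1 : ContinuousAt Λ.weierstrassP ((σ * x : ℝ) : ℂ) :=
            (Λ.hasDerivAt_weierstrassP hm).continuousAt
          exact ((ContinuousAt.comp (f := fun s : ℝ => ((σ * s : ℝ) : ℂ)) h1
            hcont.continuousAt).add continuousAt_const).norm
        have hsmall : ∀ᶠ s in 𝓝 x, ‖Λ.weierstrassP ((σ * s : ℝ) : ℂ) + b‖ < B⁻¹ := by
          apply hc.eventually_lt continuousAt_const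
          rw [hz, norm_zero]
          exact inv_pos.mpr hBpos
        have hoff : ∀ᶠ s : ℝ in 𝓝 x, ((σ * s : ℝ) : ℂ) ∉ Λ.lattice :=
          hcont.continuousAt.eventually (Λ.isOpen_compl_lattice.mem_nhds hm)
        have hnear : ∀ᶠ s in 𝓝[<] x, s ∈ Ico 0 x := by
          filter_upwards [Ioo_mem_nhdsLT h0] with s hs using ⟨hs.1.le, hs.2⟩
        obtain ⟨s, ⟨h1, h2⟩, h3⟩ :=
          (((hsmall.and hoff).filter_mono nhdsWithin_le_nhds).and hnear).exists
        obtain ⟨hr, hlt⟩ := hgood s h3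
        have hne := hr.resolve_left h2
        simp only [hY, recipWeierstrassP_of_notMem h2, norm_inv] at hlt
        exact absurd (inv_lt_of_inv_lt₀ (norm_pos_iff.mpr hne) hlt) h1.not_gt
    have hYc : ContinuousAt Y x := (hasDerivAt_recipWeierstrassP_real hreg).continuousAt
    have hYx : ‖Y x‖ < B := by
      rcases hx.1.eq_or_lt with h0 | h0
      · rw [← h0]; simpa [hY, recipWeierstrassP_zero] using hBpos
      · refine lt_of_le_of_lt ?_ hB
        have hnear : ∀ᶠ s in 𝓝[<] x, ‖Y s‖ ≤ C * Real.exp A := by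
          filter_upwards [Ioo_mem_nhdsLT h0] with s hs using hle s ⟨hs.1.le, hs.2⟩
        exact le_of_tendsto (hYc.norm.tendsto.mono_left nhdsWithin_le_nhds) hnear
    filter_upwards [hcont.continuousAt.eventually ((isOpen_recipRegular Λ b).mem_nhds hreg),
      hYc.norm.eventually_lt continuousAt_const hYx] with s h1 h2 using ⟨h1, h2⟩
  intro ψ hψ
  rcases le_total 0 ψ with h0 | h0
  · exact main ψ ⟨h0, (abs_le.mp hψ).2⟩
  · obtain ⟨h1, h2⟩ := main (-ψ) ⟨by linarith, by linarith [(abs_le.mp hψ).1]⟩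
    have he : ((σ * -ψ : ℝ) : ℂ) = -((σ * ψ : ℝ) : ℂ) := by push_cast; ring
    simp only [hY, he, neg_mem_recipRegular, recipWeierstrassP_neg] at h1 h2
    exact ⟨h1, h2⟩

end PeriodPair

/-! ### Concave radial energies -/

section ConcaveWells

open Filter Topology Set

/-- A concave function `Q` on `[0, ∞)` with derivative `Q'` that is negative at `0` and at `U` and
positive at a point `p` in between. In the variable `u = 1 / ρ`, `Q` is the radial kinetic
energy of a bounded orbit. -/
structure ConcaveWell (Q Q' : ℝ → ℝ) (p U : ℝ) : Prop where
  pos : 0 < p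
  lt : p < U
  hasDerivAt : ∀ u, HasDerivAt Q (Q' u) u
  continuous : Continuous Q'
  antitone : AntitoneOn Q' (Ici 0)
  zero_neg : Q 0 < 0
  top_pos : 0 < Q p
  end_neg : Q U < 0

namespace ConcaveWell

variable {Q Q' : ℝ → ℝ} {p U : ℝ}

theorem continuous_energy (h : ConcaveWell Q Q' p U) : Continuous Q :=
  continuous_iff_continuousAt.mpr fun u => (h.hasDerivAt u).continuousAt

theorem le_tangent (h : ConcaveWell Q Q' p U) {r s : ℝ} (hr : 0 ≤ r) (hs : 0 ≤ s) :
    Q s ≤ Q r + Q' r * (s - r) := by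
  rcases lt_trichotomy r s with hrs | rfl | hrs
  · obtain ⟨c, hc, hslope⟩ := exists_hasDerivAt_eq_slope Q Q' hrs
      h.continuous_energy.continuousOn fun x _ => h.hasDerivAt x
    have h1 : Q' c ≤ Q' r := h.antitone hr (hr.trans hc.1.le) hc.1.le
    rw [hslope, div_le_iff₀ (sub_pos.mpr hrs)] at h1
    linarith
  · simp
  · obtain ⟨c, hc, hslope⟩ := exists_hasDerivAt_eq_slope Q Q' hrs
      h.continuous_energy.continuousOn fun x _ => h.hasDerivAt x
    have h1 : Q' r ≤ Q' c := h.antitone (hs.trans hc.1.le) hr hc.2.le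
    rw [hslope, le_div_iff₀ (sub_pos.mpr hrs)] at h1
    linarith

theorem exists_roots (h : ConcaveWell Q Q' p U) :
    ∃ a b, 0 < a ∧ a < p ∧ p < b ∧ b < U ∧ Q a = 0 ∧ Q b = 0 := by
  obtain ⟨a, ha, hQa⟩ := intermediate_value_Ioo h.pos.le h.continuous_energy.continuousOn
    ⟨h.zero_neg, h.top_pos⟩
  obtain ⟨b, hb, hQb⟩ := intermediate_value_Ioo' h.lt.le h.continuous_energy.continuousOn
    ⟨h.end_neg, h.top_pos⟩
  exact ⟨a, b, ha.1, ha.2, hb.1, hb.2, hQa, hQb⟩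

variable {a b u : ℝ}

theorem deriv_pos_of_root (h : ConcaveWell Q Q' p U) (ha : 0 ≤ a) (hap : a < p) (hQa : Q a = 0) :
    0 < Q' a := by
  have h1 := h.le_tangent ha h.pos.le
  have h2 := h.top_pos
  by_contra hn
  nlinarith

theorem deriv_neg_of_root (h : ConcaveWell Q Q' p U) (hpb : p < b) (hQb : Q b = 0) :
    Q' b < 0 := by
  have h1 := h.le_tangent (h.pos.trans hpb).le h.pos.le
  have h2 := h.top_pos
  by_contra hn
  nlinarith

theorem neg_of_lt_root (h : ConcaveWell Q Q' p U) (hap : a < p) (hQa : Q a = 0)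
    (hu : 0 ≤ u) (hua : u < a) : Q u < 0 := by
  have h1 := h.le_tangent (hu.trans hua.le) hu
  have h2 := h.deriv_pos_of_root (hu.trans hua.le) hap hQa
  nlinarith

theorem neg_of_root_lt (h : ConcaveWell Q Q' p U) (hpb : p < b) (hQb : Q b = 0)
    (hbu : b < u) : Q u < 0 := by
  have hb := h.pos.trans hpb
  have h1 := h.le_tangent hb.le (hb.trans hbu).le
  have h2 := h.deriv_neg_of_root hpb hQb
  nlinarith

theorem mem_Icc_of_nonneg (h : ConcaveWell Q Q' p U) (hap : a < p) (hpb : p < b)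
    (hQa : Q a = 0) (hQb : Q b = 0) (hu : 0 ≤ u) (hQu : 0 ≤ Q u) : u ∈ Icc a b := by
  constructor
  · by_contra hn
    exact (h.neg_of_lt_root hap hQa hu (not_le.mp hn)).not_ge hQu
  · by_contra hn
    exact (h.neg_of_root_lt hpb hQb (not_le.mp hn)).not_ge hQu

theorem deriv_ne_zero_of_root (h : ConcaveWell Q Q' p U) (hu : 0 ≤ u) (hQu : Q u = 0) :
    Q' u ≠ 0 := by
  intro h0
  have h1 := h.le_tangent hu h.pos.le
  have h2 := h.top_pos
  rw [h0, hQu] at h1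
  linarith

theorem eq_or_eq_of_root (h : ConcaveWell Q Q' p U) (ha : 0 ≤ a) (hap : a < p) (hpb : p < b)
    (hQa : Q a = 0) (hQb : Q b = 0) (hu : 0 ≤ u) (hQu : Q u = 0) : u = a ∨ u = b := by
  obtain ⟨h1, h2⟩ := h.mem_Icc_of_nonneg hap hpb hQa hQb hu hQu.ge
  rcases lt_trichotomy u p with hup | hup | hup
  · left
    rcases h1.eq_or_lt with h3 | h3
    · exact h3.symm
    · exact absurd hQa (h.neg_of_lt_root hup hQu ha h3).ne
  · exact absurd hQu (hup ▸ h.top_pos.ne')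
  · right
    rcases h2.eq_or_lt with h3 | h3
    · exact h3
    · exact absurd hQb (h.neg_of_root_lt hup hQu h3).ne

/-- Lower roots of two wells with a common top point `p`, of height at least `η`, differ by at most
`p ε / η` where `ε` bounds the difference of the two functions. -/
theorem abs_lower_root_sub_le {Q₂ Q₂' : ℝ → ℝ} {U₂ a₂ η ε : ℝ} (h : ConcaveWell Q Q' p U)
    (h₂ : ConcaveWell Q₂ Q₂' p U₂) (hη : 0 < η) (hQp : η ≤ Q p) (hQ₂p : η ≤ Q₂ p)
    (ha : 0 ≤ a) (hap : a < p) (hQa : Q a = 0) (ha₂ : 0 ≤ a₂) (ha₂p : a₂ < p) (hQa₂ : Q₂ a₂ = 0)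
    (hε : ∀ u ∈ Icc 0 p, |Q u - Q₂ u| ≤ ε) : |a₂ - a| ≤ p * ε / η := by
  have hε0 : 0 ≤ ε := (abs_nonneg _).trans (hε 0 ⟨le_rfl, h.pos.le⟩)
  have key : ∀ {R R' : ℝ → ℝ} {V r s : ℝ}, ConcaveWell R R' p V → η ≤ R p → 0 ≤ r → r < p →
      R r = 0 → 0 ≤ s → s ≤ r → |R s| ≤ ε → r - s ≤ p * ε / η := by
    intro R R' V r s hR hRp hr hrp hRr hs hsr hRs
    have h1 := hR.le_tangent hr hR.pos.le
    have h2 := hR.le_tangent hr hs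
    have h3 := (abs_le.mp hRs).1
    have h4 := hR.deriv_pos_of_root hr hrp hRr
    rw [le_div_iff₀ hη]
    have h5 : R' r * (r - s) ≤ ε := by linarith
    have h6 : η ≤ R' r * p := by nlinarith
    calc (r - s) * η ≤ (r - s) * (R' r * p) := by
          apply mul_le_mul_of_nonneg_left h6; linarith
      _ = p * (R' r * (r - s)) := by ring
      _ ≤ p * ε := mul_le_mul_of_nonneg_left h5 hR.pos.le
  rcases le_total a a₂ with hle | hle
  · rw [abs_of_nonneg (by linarith)]
    refine key h₂ hQ₂p ha₂ ha₂p hQa₂ ha hle ?_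
    have := hε a ⟨ha, hap.le⟩
    rwa [hQa, zero_sub, abs_neg] at this
  · rw [abs_of_nonpos (by linarith), neg_sub]
    refine key h hQp ha hap hQa ha₂ hle ?_
    have := hε a₂ ⟨ha₂, ha₂p.le⟩
    rwa [hQa₂, sub_zero] at this

/-- The analogue of `abs_lower_root_sub_le` for the upper roots. -/
theorem abs_upper_root_sub_le {Q₂ Q₂' : ℝ → ℝ} {b₂ η ε : ℝ} (h : ConcaveWell Q Q' p U)
    (h₂ : ConcaveWell Q₂ Q₂' p U) (hη : 0 < η) (hQp : η ≤ Q p) (hQ₂p : η ≤ Q₂ p)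
    (hpb : p < b) (hbU : b ≤ U) (hQb : Q b = 0) (hpb₂ : p < b₂) (hb₂U : b₂ ≤ U)
    (hQb₂ : Q₂ b₂ = 0) (hε : ∀ u ∈ Icc 0 U, |Q u - Q₂ u| ≤ ε) : |b₂ - b| ≤ U * ε / η := by
  have hε0 : 0 ≤ ε := (abs_nonneg _).trans (hε 0 ⟨le_rfl, (h.pos.trans h.lt).le⟩)
  have key : ∀ {R R' : ℝ → ℝ} {r s : ℝ}, ConcaveWell R R' p U → η ≤ R p → p < r → r ≤ U →
      R r = 0 → r ≤ s → |R s| ≤ ε → s - r ≤ U * ε / η := by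
    intro R R' r s hR hRp hpr hrU hRr hrs hRs
    have hr : 0 ≤ r := (hR.pos.trans hpr).le
    have h1 := hR.le_tangent hr hR.pos.le
    have h2 := hR.le_tangent hr (hr.trans hrs)
    have h3 := (abs_le.mp hRs).1
    have h4 := hR.deriv_neg_of_root hpr hRr
    have h0 := hR.pos
    rw [le_div_iff₀ hη]
    have h5 : -R' r * (s - r) ≤ ε := by linarith
    have h6 : η ≤ -R' r * U := by nlinarith
    calc (s - r) * η ≤ (s - r) * (-R' r * U) := by
          apply mul_le_mul_of_nonneg_left h6; linarith
      _ = U * (-R' r * (s - r)) := by ring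
      _ ≤ U * ε := mul_le_mul_of_nonneg_left h5 (by linarith)
  rcases le_total b b₂ with hle | hle
  · rw [abs_of_nonneg (by linarith)]
    refine key h hQp hpb hbU hQb hle ?_
    have := hε b₂ ⟨(h.pos.trans hpb₂).le, hb₂U⟩
    rwa [hQb₂, sub_zero] at this
  · rw [abs_of_nonpos (by linarith), neg_sub]
    refine key h₂ hQ₂p hpb₂ hb₂U hQb₂ hle ?_
    have := hε b ⟨(h.pos.trans hpb).le, hbU⟩
    rwa [hQb, zero_sub, abs_neg] at this

end ConcaveWell

end ConcaveWells

/-! ### Oscillation of central motions -/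

section CentralMotion

open Filter Topology Set

/-- If `g` and `|g'|` converge at infinity then `|g'|` tends to zero. -/
theorem eq_zero_of_tendsto_abs_deriv {g : ℝ → ℝ} {l d : ℝ} (hg : Differentiable ℝ g)
    (hl : Tendsto g atTop (𝓝 l)) (hd : Tendsto (fun t => |deriv g t|) atTop (𝓝 d)) : d = 0 := by
  have hex : ∀ t : ℝ, ∃ c ∈ Ioo t (t + 1), deriv g c = g (t + 1) - g t := by
    intro t
    obtain ⟨c, hc, h⟩ := exists_deriv_eq_slope g (lt_add_one t) hg.continuous.continuousOn
      hg.differentiableOn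
    exact ⟨c, hc, by rw [h]; simp⟩
  choose c hc hslope using hex
  have hc_top : Tendsto c atTop atTop := tendsto_atTop_mono (fun t => (hc t).1.le) tendsto_id
  have h1 := hd.comp hc_top
  have h2 : Tendsto (fun t => |g (t + 1) - g t|) atTop (𝓝 |l - l|) :=
    ((hl.comp (tendsto_atTop_add_const_right _ 1 tendsto_id)).sub hl).abs
  rw [sub_self, abs_zero] at h2
  refine tendsto_nhds_unique h1 (h2.congr fun t => ?_)
  simp [hslope]

/-- A differentiable bounded function without critical points on a half-line converges. -/
theorem exists_tendsto_of_deriv_ne_zero {g : ℝ → ℝ} {t₁ m M : ℝ} (hg : Differentiable ℝ g)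
    (hb : ∀ t, g t ∈ Icc m M) (hne : ∀ t, t₁ ≤ t → deriv g t ≠ 0) :
    ∃ l, Tendsto g atTop (𝓝 l) := by
  have key : ∀ f : ℝ → ℝ, ∀ C, MonotoneOn f (Ici t₁) → (∀ t, f t ≤ C) →
      ∃ l, Tendsto f atTop (𝓝 l) := by
    intro f C hmono hC
    have hm : Monotone fun t => f (max t t₁) := fun s t hst =>
      hmono (mem_Ici.mpr (le_max_right s t₁)) (mem_Ici.mpr (le_max_right t t₁)) (max_le_max hst le_rfl)
    refine ⟨_, (tendsto_atTop_ciSup hm ⟨C, ?_⟩).congr' ?_⟩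
    · rintro _ ⟨t, rfl⟩; exact hC _
    · filter_upwards [eventually_ge_atTop t₁] with t ht
      rw [max_eq_left ht]
  rcases hasDerivWithinAt_forall_lt_or_forall_gt_of_forall_ne (m := 0) (convex_Ici t₁)
    (fun t _ => (hg t).hasDerivAt.hasDerivWithinAt) (fun t ht => hne t ht) with h | h
  · have hanti : StrictAntiOn g (Ici t₁) := strictAntiOn_of_deriv_neg (convex_Ici t₁)
      hg.continuous.continuousOn fun t ht => h t (interior_subset ht)
    obtain ⟨l, hl⟩ := key (fun t => -g t) (-m) hanti.antitoneOn.neg fun t => neg_le_neg (hb t).1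
    exact ⟨-l, by simpa using hl.neg⟩
  · have hmono : StrictMonoOn g (Ici t₁) := strictMonoOn_of_deriv_pos (convex_Ici t₁)
      hg.continuous.continuousOn fun t ht => h t (interior_subset ht)
    exact key g M hmono.monotoneOn fun t => (hb t).2

/-- A function whose critical values are `A` and `B`, with nondegenerate critical points at
arbitrarily late times, takes the value `A` after its maximum `B`. -/
theorem exists_eq_of_critical_values {g : ℝ → ℝ} {A B t₁ : ℝ} (hg : Differentiable ℝ g)
    (hcrit : ∀ t, deriv g t = 0 → g t = A ∨ g t = B)
    (hnd : ∀ t, deriv g t = 0 → deriv (deriv g) t ≠ 0)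
    (hlate : ∀ T, ∃ t, T ≤ t ∧ deriv g t = 0) (h₁ : g t₁ = B) (hB : ∀ t, g t ≤ B) :
    ∃ t, g t = A := by
  obtain ⟨t₂, ht₂, hd₂⟩ := hlate (t₁ + 1)
  have hlt : t₁ < t₂ := by linarith
  rcases hcrit t₂ hd₂ with h₂ | h₂
  · exact ⟨t₂, h₂⟩
  obtain ⟨c, hc, hmin⟩ := isCompact_Icc.exists_isMinOn (nonempty_Icc.mpr hlt.le)
    hg.continuous.continuousOn
  by_cases hcB : g c = B
  · -- the minimum equals the maximum: `g` is constant, so it has a degenerate critical point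
    have hconst : ∀ t ∈ Icc t₁ t₂, g t = B := fun t ht => le_antisymm (hB t) (hcB ▸ hmin ht)
    have hev : ∀ t ∈ Ioo t₁ t₂, deriv g t = 0 := by
      intro t ht
      have : g =ᶠ[𝓝 t] fun _ => B := by
        filter_upwards [Ioo_mem_nhds ht.1 ht.2] with s hs using hconst s (Ioo_subset_Icc_self hs)
      rw [this.deriv_eq, deriv_const]
    obtain ⟨t, ht⟩ := exists_between hlt
    have hdd : deriv g =ᶠ[𝓝 t] fun _ => 0 := by
      filter_upwards [Ioo_mem_nhds ht.1 ht.2] with s hs using hev s hs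
    exact absurd (by rw [hdd.deriv_eq, deriv_const]) (hnd t (hev t ht))
  · have hc₁ : c ≠ t₁ := by rintro rfl; exact hcB h₁
    have hc₂ : c ≠ t₂ := by rintro rfl; exact hcB h₂
    have hloc : IsLocalMin g c := hmin.isLocalMin
      (Icc_mem_nhds (lt_of_le_of_ne hc.1 hc₁.symm) (lt_of_le_of_ne hc.2 hc₂))
    exact ⟨c, (hcrit c hloc.deriv_eq_zero).resolve_right hcB⟩

/-- The radial energy and the radial force of a central field, in terms of a function `Q` of
`u = 1 / x` and its derivative `Q'`. -/
structure HasRadialEnergy (f V : ℝ → ℝ) (L E : ℝ) (Q Q' : ℝ → ℝ) : Prop where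
  energy : ∀ x, 0 < x → E - L ^ 2 / (2 * x ^ 2) - V x = Q x⁻¹
  force : ∀ x, 0 < x → L ^ 2 / x ^ 3 + f x = -(Q' x⁻¹ * x⁻¹ ^ 2)

variable {f V Q Q' ρ φ : ℝ → ℝ} {L E p U a b : ℝ}

theorem IsCentralMotion.deriv_sq (hM : IsCentralMotion f V L E ρ φ)
    (hQ : HasRadialEnergy f V L E Q Q') (t : ℝ) : deriv ρ t ^ 2 / 2 = Q (ρ t)⁻¹ := by
  have h1 := hM.energy t
  have h2 := hQ.energy (ρ t) (hM.pos t)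
  linarith

theorem IsCentralMotion.inv_mem_Icc (hM : IsCentralMotion f V L E ρ φ)
    (hQ : HasRadialEnergy f V L E Q Q') (hW : ConcaveWell Q Q' p U) (hap : a < p) (hpb : p < b)
    (hQa : Q a = 0) (hQb : Q b = 0) (t : ℝ) : (ρ t)⁻¹ ∈ Icc a b := by
  refine hW.mem_Icc_of_nonneg hap hpb hQa hQb (inv_pos.mpr (hM.pos t)).le ?_
  rw [← hM.deriv_sq hQ t]
  positivity

theorem IsCentralMotion.deriv_deriv (hM : IsCentralMotion f V L E ρ φ)
    (hQ : HasRadialEnergy f V L E Q Q') (t : ℝ) :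
    deriv (deriv ρ) t = -(Q' (ρ t)⁻¹ * (ρ t)⁻¹ ^ 2) := by
  rw [(hM.radial t).deriv, hQ.force _ (hM.pos t)]

/-- Without apsides after the time `T`, `ρ` would converge to a point where `Q` and `Q'` both
vanish. -/
theorem IsCentralMotion.exists_late_apsis (hM : IsCentralMotion f V L E ρ φ)
    (hQ : HasRadialEnergy f V L E Q Q') (hW : ConcaveWell Q Q' p U) (ha : 0 < a) (hap : a < p)
    (hpb : p < b) (hQa : Q a = 0) (hQb : Q b = 0) (T : ℝ) : ∃ t, T ≤ t ∧ deriv ρ t = 0 := by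
  by_contra! hne
  have hb : 0 < b := ha.trans (hap.trans hpb)
  have hmem : ∀ t, ρ t ∈ Icc b⁻¹ a⁻¹ := by
    intro t
    obtain ⟨h1, h2⟩ := hM.inv_mem_Icc hQ hW hap hpb hQa hQb t
    exact ⟨inv_le_of_inv_le₀ (hM.pos t) h2, le_inv_of_le_inv₀ ha h1⟩
  obtain ⟨l, hl⟩ := exists_tendsto_of_deriv_ne_zero hM.differentiable hmem hne
  have hl0 : 0 < l := (inv_pos.mpr hb).trans_le (ge_of_tendsto' hl fun t => (hmem t).1)
  have hinv : Tendsto (fun t => (ρ t)⁻¹) atTop (𝓝 l⁻¹) := hl.inv₀ hl0.ne'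
  have habs : Tendsto (fun t => |deriv ρ t|) atTop (𝓝 √(2 * Q l⁻¹)) := by
    have h1 : Tendsto (fun t => √(2 * Q (ρ t)⁻¹)) atTop (𝓝 √(2 * Q l⁻¹)) :=
      (((hW.continuous_energy.tendsto _).comp hinv).const_mul 2).sqrt
    refine h1.congr fun t => ?_
    rw [← hM.deriv_sq hQ t, mul_div_cancel₀ _ two_ne_zero, Real.sqrt_sq_eq_abs]
  have hzero := eq_zero_of_tendsto_abs_deriv hM.differentiable hl habs
  have hQl : Q l⁻¹ = 0 := by
    have h1 : 0 ≤ Q l⁻¹ := ge_of_tendsto' ((hW.continuous_energy.tendsto _).comp hinv)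
      fun t => by
        change 0 ≤ Q (ρ t)⁻¹
        rw [← hM.deriv_sq hQ t]; positivity
    have h2 := Real.sqrt_eq_zero'.mp hzero
    linarith
  rw [hzero] at habs
  have hρ' : Tendsto (deriv ρ) atTop (𝓝 0) := (tendsto_zero_iff_abs_tendsto_zero _).mpr habs
  have hρ'' : Tendsto (fun t => |deriv (deriv ρ) t|) atTop (𝓝 |-(Q' l⁻¹ * l⁻¹ ^ 2)|) := by
    simp only [hM.deriv_deriv hQ]
    exact ((((hW.continuous.tendsto _).comp hinv).mul (hinv.pow 2)).neg).abs
  have h3 := eq_zero_of_tendsto_abs_deriv (fun t => (hM.radial t).differentiableAt) hρ' hρ''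
  have h4 := hW.deriv_ne_zero_of_root (inv_pos.mpr hl0).le hQl
  simp [h4, hl0.ne'] at h3

/-- A motion whose radial energy is a concave well oscillates between the two roots. -/
theorem IsCentralMotion.range_of_concaveWell (hM : IsCentralMotion f V L E ρ φ)
    (hQ : HasRadialEnergy f V L E Q Q') (hW : ConcaveWell Q Q' p U) (ha : 0 < a) (hap : a < p)
    (hpb : p < b) (hQa : Q a = 0) (hQb : Q b = 0) :
    IsGreatest (range ρ) a⁻¹ ∧ IsLeast (range ρ) b⁻¹ ∧
      ∀ t, ρ t ∈ Ioo b⁻¹ a⁻¹ ↔ deriv ρ t ≠ 0 := by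
  have hb : 0 < b := ha.trans (hap.trans hpb)
  have hmem : ∀ t, ρ t ∈ Icc b⁻¹ a⁻¹ := by
    intro t
    obtain ⟨h1, h2⟩ := hM.inv_mem_Icc hQ hW hap hpb hQa hQb t
    exact ⟨inv_le_of_inv_le₀ (hM.pos t) h2, le_inv_of_le_inv₀ ha h1⟩
  have hd0 : ∀ t, deriv ρ t = 0 ↔ Q (ρ t)⁻¹ = 0 := by
    intro t
    rw [← hM.deriv_sq hQ t]; simp
  have hcrit : ∀ t, deriv ρ t = 0 → ρ t = b⁻¹ ∨ ρ t = a⁻¹ := by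
    intro t ht
    rcases hW.eq_or_eq_of_root ha.le hap hpb hQa hQb (inv_pos.mpr (hM.pos t)).le
      ((hd0 t).mp ht) with h | h
    · right; rw [← h, inv_inv]
    · left; rw [← h, inv_inv]
  have hnd : ∀ t, deriv ρ t = 0 → deriv (deriv ρ) t ≠ 0 := by
    intro t ht
    have h := hW.deriv_ne_zero_of_root (inv_pos.mpr (hM.pos t)).le ((hd0 t).mp ht)
    rw [hM.deriv_deriv hQ]
    simp [h, (hM.pos t).ne']
  have hlate := hM.exists_late_apsis hQ hW ha hap hpb hQa hQb
  have hboth : (∃ t, ρ t = a⁻¹) ∧ ∃ t, ρ t = b⁻¹ := by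
    obtain ⟨t₁, -, h₁⟩ := hlate 0
    rcases hcrit t₁ h₁ with h | h
    · refine ⟨?_, t₁, h⟩
      -- the maximum is the minimum of `-ρ`
      have hneg : deriv (fun t => -ρ t) = fun t => -deriv ρ t := funext fun t => deriv.fun_neg
      have hneg2 : deriv (deriv fun t => -ρ t) = fun t => -deriv (deriv ρ) t := by
        rw [hneg]; exact funext fun t => deriv.fun_neg
      obtain ⟨t, ht⟩ := exists_eq_of_critical_values (g := fun t => -ρ t) (A := -a⁻¹)
        (B := -b⁻¹) (t₁ := t₁) hM.differentiable.neg
        (fun t ht => by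
          rw [hneg, neg_eq_zero] at ht
          rcases hcrit t ht with h | h
          · right; rw [h]
          · left; rw [h])
        (fun t ht => by
          rw [hneg, neg_eq_zero] at ht
          rw [hneg2]
          exact neg_ne_zero.mpr (hnd t ht))
        (fun T => by
          obtain ⟨t, h1, h2⟩ := hlate T
          exact ⟨t, h1, by simp only [hneg, h2, neg_zero]⟩)
        (by rw [h]) (fun t => neg_le_neg (hmem t).1)
      exact ⟨t, neg_injective ht⟩
    · exact ⟨⟨t₁, h⟩, exists_eq_of_critical_values hM.differentiable hcrit hnd hlate h
        fun t => (hmem t).2⟩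
  refine ⟨⟨hboth.1, ?_⟩, ⟨hboth.2, ?_⟩, fun t => ⟨fun ht h0 => ?_, fun ht => ?_⟩⟩
  · rintro _ ⟨t, rfl⟩; exact (hmem t).2
  · rintro _ ⟨t, rfl⟩; exact (hmem t).1
  · rcases hcrit t h0 with h | h
    · exact ht.1.ne' h
    · exact ht.2.ne h
  · refine ⟨lt_of_le_of_ne (hmem t).1 fun h => ht ((hd0 t).mpr ?_),
      lt_of_le_of_ne (hmem t).2 fun h => ht ((hd0 t).mpr ?_)⟩
    · rw [← h, inv_inv, hQb]
    · rw [h, inv_inv, hQa]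

end CentralMotion

/-! ### The radial energies of the two kinds of orbits -/

section OrbitEnergies

open Set

/-- The radial kinetic energy of a first-order orbit as a function of `u = 1 / ρ`. -/
noncomputable def firstOrderEnergy (μ₁ μ₂ r₀ L E u : ℝ) : ℝ :=
  E + (μ₁ + μ₂) * u - L ^ 2 / 2 * u ^ 2 - μ₂ * r₀ ^ 2 / 2 * u ^ 3

/-- The derivative of `firstOrderEnergy`. -/
noncomputable def firstOrderSlope (μ₁ μ₂ r₀ L u : ℝ) : ℝ :=
  μ₁ + μ₂ - L ^ 2 * u - 3 / 2 * (μ₂ * r₀ ^ 2) * u ^ 2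

/-- The radial kinetic energy of an isosceles triangle orbit as a function of `u = 1 / ρ`;
`γ` stands for `c²`. -/
noncomputable def isoscelesEnergy (μ₁ μ₂ γ L E u : ℝ) : ℝ :=
  E + (μ₁ + μ₂) * (u / √(1 + γ * u ^ 2)) - L ^ 2 / 2 * u ^ 2

/-- The derivative of `isoscelesEnergy`. -/
noncomputable def isoscelesSlope (μ₁ μ₂ γ L u : ℝ) : ℝ :=
  (μ₁ + μ₂) / √(1 + γ * u ^ 2) ^ 3 - L ^ 2 * u

theorem cSq_eq {μ₁ μ₂ : ℝ} (r₀ : ℝ) (h₁ : 0 < μ₁) (h₂ : 0 < μ₂) :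
    cSq μ₁ μ₂ r₀ = μ₂ * r₀ ^ 2 / μ₁ := by
  unfold cSq separation
  field_simp
  ring

theorem hasDerivAt_firstOrderEnergy (μ₁ μ₂ r₀ L E u : ℝ) :
    HasDerivAt (firstOrderEnergy μ₁ μ₂ r₀ L E) (firstOrderSlope μ₁ μ₂ r₀ L u) u := by
  have h := ((((hasDerivAt_id u).const_mul (μ₁ + μ₂)).const_add E).sub
    (((hasDerivAt_id u).pow 2).const_mul (L ^ 2 / 2))).sub
    (((hasDerivAt_id u).pow 3).const_mul (μ₂ * r₀ ^ 2 / 2))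
  refine (h.congr_deriv ?_)
  simp [firstOrderSlope]; ring

theorem hasDerivAt_isoscelesEnergy {γ : ℝ} (hγ : 0 ≤ γ) (μ₁ μ₂ L E u : ℝ) :
    HasDerivAt (isoscelesEnergy μ₁ μ₂ γ L E) (isoscelesSlope μ₁ μ₂ γ L u) u := by
  have hpos : 0 < 1 + γ * u ^ 2 := by positivity
  have hs : 0 < √(1 + γ * u ^ 2) := Real.sqrt_pos.mpr hpos
  have h1 : HasDerivAt (fun x : ℝ => 1 + γ * x ^ 2) (γ * (2 * u)) u := by
    simpa using ((hasDerivAt_pow 2 u).const_mul γ).const_add 1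
  have h2 := (hasDerivAt_id u).div (h1.sqrt hpos.ne') hs.ne'
  have h := ((h2.const_mul (μ₁ + μ₂)).const_add E).sub
    (((hasDerivAt_id u).pow 2).const_mul (L ^ 2 / 2))
  refine (h.congr_deriv ?_)
  have hsq : √(1 + γ * u ^ 2) ^ 2 = 1 + γ * u ^ 2 := Real.sq_sqrt hpos.le
  simp only [isoscelesSlope, id]
  generalize √(1 + γ * u ^ 2) = s at *
  field_simp
  push_cast
  linear_combination (2 * (μ₁ + μ₂)) * hsq

theorem firstOrder_hasRadialEnergy (μ₁ μ₂ r₀ L E : ℝ) :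
    HasRadialEnergy (fun x => -((μ₁ + μ₂) / x ^ 2) + 3 * μ₂ * r₀ ^ 2 / (2 * x ^ 4))
      (fun x => -((μ₁ + μ₂) / x) + μ₂ * r₀ ^ 2 / (2 * x ^ 3)) L E
      (firstOrderEnergy μ₁ μ₂ r₀ L E) (firstOrderSlope μ₁ μ₂ r₀ L) where
  energy x hx := by
    simp only [firstOrderEnergy]; field_simp; ring
  force x hx := by
    simp only [firstOrderSlope]; field_simp; ring

theorem sqrt_one_add_mul_inv_sq {γ x : ℝ} (hx : 0 < x) :
    √(1 + γ * x⁻¹ ^ 2) = √(x ^ 2 + γ) / x := by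
  have h : 1 + γ * x⁻¹ ^ 2 = (x ^ 2 + γ) / x ^ 2 := by field_simp
  rw [h, Real.sqrt_div' _ (sq_nonneg x), Real.sqrt_sq hx.le]

theorem isosceles_hasRadialEnergy {γ : ℝ} (hγ : 0 ≤ γ) (μ₁ μ₂ L E : ℝ) :
    HasRadialEnergy (fun x => -((μ₁ + μ₂) * x / √(x ^ 2 + γ) ^ 3))
      (fun x => -((μ₁ + μ₂) / √(x ^ 2 + γ))) L E
      (isoscelesEnergy μ₁ μ₂ γ L E) (isoscelesSlope μ₁ μ₂ γ L) where
  energy x hx := by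
    have hs : 0 < √(x ^ 2 + γ) := Real.sqrt_pos.mpr (by positivity)
    simp only [isoscelesEnergy, sqrt_one_add_mul_inv_sq hx]; field_simp; ring
  force x hx := by
    have hs : 0 < √(x ^ 2 + γ) := Real.sqrt_pos.mpr (by positivity)
    simp only [isoscelesSlope, sqrt_one_add_mul_inv_sq hx]; field_simp; ring

/-- With `s = √(1 + x)` the left-hand side is a multiple of `(s - 1)²`. -/
theorem abs_inv_sqrt_sub_le {x : ℝ} (hx : 0 ≤ x) :
    |1 / √(1 + x) - (1 - x / 2)| ≤ x ^ 2 := by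
  have hs : 1 ≤ √(1 + x) := by rw [Real.one_le_sqrt]; linarith
  have hsq : √(1 + x) ^ 2 = 1 + x := Real.sq_sqrt (by linarith)
  generalize √(1 + x) = s at *
  obtain rfl : x = s ^ 2 - 1 := by linarith
  have hs0 : 0 < s := by linarith
  have h : 1 / s - (1 - (s ^ 2 - 1) / 2) = (s - 1) ^ 2 * ((s + 2) / (2 * s)) := by
    field_simp; ring
  have h1 : (s + 2) / (2 * s) ≤ (s + 1) ^ 2 := by
    rw [div_le_iff₀ (by linarith)]; nlinarith [mul_nonneg hs0.le hs0.le]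
  rw [h, abs_of_nonneg (by positivity)]
  calc _ ≤ (s - 1) ^ 2 * (s + 1) ^ 2 := by gcongr
    _ = (s ^ 2 - 1) ^ 2 := by ring

theorem abs_inv_sqrt_cube_sub_le {x : ℝ} (hx : 0 ≤ x) :
    |1 / √(1 + x) ^ 3 - (1 - 3 / 2 * x)| ≤ 2 * x ^ 2 := by
  have hs : 1 ≤ √(1 + x) := by rw [Real.one_le_sqrt]; linarith
  have hsq : √(1 + x) ^ 2 = 1 + x := Real.sq_sqrt (by linarith)
  generalize √(1 + x) = s at *
  obtain rfl : x = s ^ 2 - 1 := by linarith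
  have hs0 : 0 < s := by linarith
  have h : 1 / s ^ 3 - (1 - 3 / 2 * (s ^ 2 - 1)) =
      (s - 1) ^ 2 * ((3 * s ^ 3 + 6 * s ^ 2 + 4 * s + 2) / (2 * s ^ 3)) := by
    field_simp; ring
  have h1 : (3 * s ^ 3 + 6 * s ^ 2 + 4 * s + 2) / (2 * s ^ 3) ≤ 2 * (s + 1) ^ 2 := by
    rw [div_le_iff₀ (by positivity)]
    have h2 : s ^ 2 ≤ s ^ 3 := pow_le_pow_right₀ hs (by norm_num)
    have h3 : s ≤ s ^ 3 := by nlinarith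
    have h4 : 1 ≤ s ^ 3 := one_le_pow₀ hs
    have h5 : 4 ≤ (s + 1) ^ 2 := by nlinarith
    nlinarith
  rw [h, abs_of_nonneg (by positivity)]
  calc _ ≤ (s - 1) ^ 2 * (2 * (s + 1) ^ 2) := by gcongr
    _ = 2 * (s ^ 2 - 1) ^ 2 := by ring

variable {μ₁ μ₂ r₀ L E : ℝ}

/-- The two radial energies agree up to second order in `μ₂`. -/
theorem abs_energy_sub_le (h₁ : 0 < μ₁) (h₂ : 0 < μ₂) (h₂₁ : μ₂ ≤ μ₁) {u U : ℝ}
    (hu : 0 ≤ u) (huU : u ≤ U) :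
    |firstOrderEnergy μ₁ μ₂ r₀ L E u - isoscelesEnergy μ₁ μ₂ (μ₂ * r₀ ^ 2 / μ₁) L E u| ≤
      (2 * μ₁ * U * (r₀ ^ 2 / μ₁ * U ^ 2) ^ 2 + r₀ ^ 2 / (2 * μ₁) * U ^ 3) * μ₂ ^ 2 := by
  set x := μ₂ * r₀ ^ 2 / μ₁ * u ^ 2 with hx
  have hx0 : 0 ≤ x := by positivity
  have hxU : x ≤ μ₂ * (r₀ ^ 2 / μ₁ * U ^ 2) := by
    calc x = μ₂ * (r₀ ^ 2 / μ₁ * u ^ 2) := by rw [hx]; ring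
      _ ≤ _ := by gcongr
  have h := abs_inv_sqrt_sub_le hx0
  have hid : firstOrderEnergy μ₁ μ₂ r₀ L E u - isoscelesEnergy μ₁ μ₂ (μ₂ * r₀ ^ 2 / μ₁) L E u =
      -((μ₁ + μ₂) * u * (1 / √(1 + x) - (1 - x / 2))) + r₀ ^ 2 / (2 * μ₁) * u ^ 3 * μ₂ ^ 2 := by
    simp only [firstOrderEnergy, isoscelesEnergy, ← hx]
    generalize √(1 + x) = s
    rw [hx]
    field_simp
    ring
  rw [hid]
  refine (abs_add_le _ _).trans ?_
  rw [abs_neg, abs_mul, abs_of_nonneg (show 0 ≤ (μ₁ + μ₂) * u by positivity),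
    abs_of_nonneg (show 0 ≤ r₀ ^ 2 / (2 * μ₁) * u ^ 3 * μ₂ ^ 2 by positivity),
    add_mul _ _ (μ₂ ^ 2)]
  have hU : 0 ≤ U := hu.trans huU
  gcongr ?_ + ?_
  · calc (μ₁ + μ₂) * u * |1 / √(1 + x) - (1 - x / 2)|
        ≤ (2 * μ₁) * U * (μ₂ * (r₀ ^ 2 / μ₁ * U ^ 2)) ^ 2 := by
          have h3 := h.trans (pow_le_pow_left₀ hx0 hxU 2)
          gcongr
          linarith
      _ = _ := by ring
  · gcongr

/-- The two slopes agree up to second order in `μ₂`. -/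
theorem abs_slope_sub_le (h₁ : 0 < μ₁) (h₂ : 0 < μ₂) (h₂₁ : μ₂ ≤ μ₁) {u U : ℝ}
    (hu : 0 ≤ u) (huU : u ≤ U) :
    |firstOrderSlope μ₁ μ₂ r₀ L u - isoscelesSlope μ₁ μ₂ (μ₂ * r₀ ^ 2 / μ₁) L u| ≤
      (2 * μ₁ * (2 * (r₀ ^ 2 / μ₁ * U ^ 2) ^ 2) + 3 * r₀ ^ 2 / (2 * μ₁) * U ^ 2) * μ₂ ^ 2 := by
  set x := μ₂ * r₀ ^ 2 / μ₁ * u ^ 2 with hx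
  have hx0 : 0 ≤ x := by positivity
  have hxU : x ≤ μ₂ * (r₀ ^ 2 / μ₁ * U ^ 2) := by
    calc x = μ₂ * (r₀ ^ 2 / μ₁ * u ^ 2) := by rw [hx]; ring
      _ ≤ _ := by gcongr
  have h := abs_inv_sqrt_cube_sub_le hx0
  have hid : firstOrderSlope μ₁ μ₂ r₀ L u - isoscelesSlope μ₁ μ₂ (μ₂ * r₀ ^ 2 / μ₁) L u =
      -((μ₁ + μ₂) * (1 / √(1 + x) ^ 3 - (1 - 3 / 2 * x))) +
        3 * r₀ ^ 2 / (2 * μ₁) * u ^ 2 * μ₂ ^ 2 := by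
    simp only [firstOrderSlope, isoscelesSlope, ← hx]
    generalize √(1 + x) = s
    rw [hx]
    field_simp
    ring
  rw [hid]
  refine (abs_add_le _ _).trans ?_
  rw [abs_neg, abs_mul, abs_of_nonneg (show 0 ≤ μ₁ + μ₂ by positivity),
    abs_of_nonneg (show 0 ≤ 3 * r₀ ^ 2 / (2 * μ₁) * u ^ 2 * μ₂ ^ 2 by positivity),
    add_mul _ _ (μ₂ ^ 2)]
  have hU : 0 ≤ U := hu.trans huU
  gcongr ?_ + ?_
  · calc (μ₁ + μ₂) * |1 / √(1 + x) ^ 3 - (1 - 3 / 2 * x)|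
        ≤ (2 * μ₁) * (2 * (μ₂ * (r₀ ^ 2 / μ₁ * U ^ 2)) ^ 2) := by
          have h3 := h.trans (mul_le_mul_of_nonneg_left (pow_le_pow_left₀ hx0 hxU 2) zero_le_two)
          gcongr
          linarith
      _ = _ := by ring
  · gcongr

/-- Half of the value of the Kepler energy at the inverse of the circular radius `L² / μ₁`. -/
noncomputable def wellHeight (μ₁ L E : ℝ) : ℝ := (E + μ₁ ^ 2 / (2 * L ^ 2)) / 2

/-- A range of `μ₂` in which both radial energies are wells around `μ₁ / L²`, of height at least
`wellHeight`. -/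
noncomputable def smallMass (μ₁ r₀ L E : ℝ) : ℝ :=
  min (min μ₁ 1) (wellHeight μ₁ L E / (r₀ ^ 2 * (μ₁ / L ^ 2) ^ 3))

theorem wellHeight_pos (hE' : -(μ₁ ^ 2 / (2 * L ^ 2)) < E) : 0 < wellHeight μ₁ L E := by
  unfold wellHeight; linarith

theorem smallMass_pos (h₁ : 0 < μ₁) (hr : 0 < r₀) (hL : L ≠ 0)
    (hE' : -(μ₁ ^ 2 / (2 * L ^ 2)) < E) : 0 < smallMass μ₁ r₀ L E := by
  have := wellHeight_pos hE'
  unfold smallMass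
  have hL2 : 0 < L ^ 2 := by positivity
  refine lt_min (lt_min h₁ one_pos) (by positivity)

theorem mul_cube_le_wellHeight (h₁ : 0 < μ₁) (hr : 0 < r₀) (hL : L ≠ 0)
    (hδ : μ₂ < smallMass μ₁ r₀ L E) :
    μ₂ * (r₀ ^ 2 * (μ₁ / L ^ 2) ^ 3) ≤ wellHeight μ₁ L E := by
  have hL2 : 0 < L ^ 2 := by positivity
  exact (le_div_iff₀ (by positivity)).mp (hδ.le.trans (min_le_right _ _))

theorem kepler_top (hL : L ≠ 0) : E + μ₁ * (μ₁ / L ^ 2) - L ^ 2 / 2 * (μ₁ / L ^ 2) ^ 2 =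
    2 * wellHeight μ₁ L E := by
  unfold wellHeight; field_simp; ring

theorem kepler_end (hL : L ≠ 0) : E + (μ₁ + μ₁) * (4 * μ₁ / L ^ 2) -
    L ^ 2 / 2 * (4 * μ₁ / L ^ 2) ^ 2 = E := by
  field_simp; ring

theorem firstOrder_concaveWell (h₁ : 0 < μ₁) (hr : 0 < r₀) (hL : L ≠ 0) (hE : E < 0)
    (hE' : -(μ₁ ^ 2 / (2 * L ^ 2)) < E) (h₂ : 0 < μ₂) (hδ : μ₂ < smallMass μ₁ r₀ L E) :
    ConcaveWell (firstOrderEnergy μ₁ μ₂ r₀ L E) (firstOrderSlope μ₁ μ₂ r₀ L) (μ₁ / L ^ 2)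
      (4 * μ₁ / L ^ 2) ∧ wellHeight μ₁ L E ≤ firstOrderEnergy μ₁ μ₂ r₀ L E (μ₁ / L ^ 2) := by
  have hL2 : 0 < L ^ 2 := by positivity
  have hp : 0 < μ₁ / L ^ 2 := by positivity
  have hη := wellHeight_pos hE'
  have hμ : μ₂ < μ₁ := hδ.trans_le ((min_le_left _ _).trans (min_le_left _ _))
  have htop : wellHeight μ₁ L E ≤ firstOrderEnergy μ₁ μ₂ r₀ L E (μ₁ / L ^ 2) := by
    have h3 := mul_cube_le_wellHeight h₁ hr hL hδ
    have h4 := kepler_top (μ₁ := μ₁) (E := E) hL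
    simp only [firstOrderEnergy]
    have h5 : 0 ≤ μ₂ * (μ₁ / L ^ 2) := by positivity
    nlinarith
  refine ⟨⟨hp, ?_, hasDerivAt_firstOrderEnergy _ _ _ _ _, ?_, ?_, ?_, hη.trans_le htop, ?_⟩, htop⟩
  · rw [mul_div_assoc]; linarith
  · unfold firstOrderSlope; fun_prop
  · intro u hu v hv huv
    simp only [firstOrderSlope]
    have hu' : 0 ≤ u := hu
    gcongr
  · simpa [firstOrderEnergy] using hE
  · have h4 := kepler_end (μ₁ := μ₁) (E := E) hL
    have h5 : (μ₁ + μ₂) * (4 * μ₁ / L ^ 2) ≤ (μ₁ + μ₁) * (4 * μ₁ / L ^ 2) := by gcongr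
    have h6 : 0 ≤ μ₂ * r₀ ^ 2 / 2 * (4 * μ₁ / L ^ 2) ^ 3 := by positivity
    simp only [firstOrderEnergy]
    linarith

theorem isosceles_concaveWell (h₁ : 0 < μ₁) (hr : 0 < r₀) (hL : L ≠ 0) (hE : E < 0)
    (hE' : -(μ₁ ^ 2 / (2 * L ^ 2)) < E) (h₂ : 0 < μ₂) (hδ : μ₂ < smallMass μ₁ r₀ L E) :
    ConcaveWell (isoscelesEnergy μ₁ μ₂ (μ₂ * r₀ ^ 2 / μ₁) L E)
      (isoscelesSlope μ₁ μ₂ (μ₂ * r₀ ^ 2 / μ₁) L) (μ₁ / L ^ 2) (4 * μ₁ / L ^ 2) ∧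
      wellHeight μ₁ L E ≤ isoscelesEnergy μ₁ μ₂ (μ₂ * r₀ ^ 2 / μ₁) L E (μ₁ / L ^ 2) := by
  have hL2 : 0 < L ^ 2 := by positivity
  have hp : 0 < μ₁ / L ^ 2 := by positivity
  have hη := wellHeight_pos hE'
  have hμ : μ₂ < μ₁ := hδ.trans_le ((min_le_left _ _).trans (min_le_left _ _))
  have hγ : 0 ≤ μ₂ * r₀ ^ 2 / μ₁ := by positivity
  have hone : ∀ u, 1 ≤ √(1 + μ₂ * r₀ ^ 2 / μ₁ * u ^ 2) := fun u => by
    rw [Real.one_le_sqrt]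
    have : 0 ≤ μ₂ * r₀ ^ 2 / μ₁ * u ^ 2 := by positivity
    linarith
  have htop : wellHeight μ₁ L E ≤ isoscelesEnergy μ₁ μ₂ (μ₂ * r₀ ^ 2 / μ₁) L E (μ₁ / L ^ 2) := by
    have h3 := mul_cube_le_wellHeight h₁ hr hL hδ
    have h4 := kepler_top (μ₁ := μ₁) (E := E) hL
    set P := μ₁ / L ^ 2
    -- `1 / √(1 + x) ≥ 1 - x / 2`
    have h5 : 1 - μ₂ * r₀ ^ 2 / μ₁ * P ^ 2 / 2 ≤ 1 / √(1 + μ₂ * r₀ ^ 2 / μ₁ * P ^ 2) := by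
      have hsq : √(1 + μ₂ * r₀ ^ 2 / μ₁ * P ^ 2) ^ 2 = 1 + μ₂ * r₀ ^ 2 / μ₁ * P ^ 2 :=
        Real.sq_sqrt (by positivity)
      have hs := hone P
      rw [le_div_iff₀ (by linarith)]
      generalize √(1 + μ₂ * r₀ ^ 2 / μ₁ * P ^ 2) = s at *
      have hx : μ₂ * r₀ ^ 2 / μ₁ * P ^ 2 = s ^ 2 - 1 := by linarith
      rw [hx]
      nlinarith [mul_nonneg (sq_nonneg (s - 1)) (show 0 ≤ s + 2 by linarith)]
    have h6 : (μ₁ + μ₂) * P * (1 - μ₂ * r₀ ^ 2 / μ₁ * P ^ 2 / 2) ≤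
        (μ₁ + μ₂) * (P / √(1 + μ₂ * r₀ ^ 2 / μ₁ * P ^ 2)) := by
      rw [div_eq_mul_one_div P, ← mul_assoc]
      gcongr
    have h7 : (μ₁ + μ₂) * P * (μ₂ * r₀ ^ 2 / μ₁ * P ^ 2 / 2) ≤ μ₂ * (r₀ ^ 2 * P ^ 3) := by
      calc (μ₁ + μ₂) * P * (μ₂ * r₀ ^ 2 / μ₁ * P ^ 2 / 2)
          ≤ (μ₁ + μ₁) * P * (μ₂ * r₀ ^ 2 / μ₁ * P ^ 2 / 2) := by gcongr
        _ = _ := by field_simp; ring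
    have h8 : 0 ≤ μ₂ * P := by positivity
    simp only [isoscelesEnergy]
    nlinarith
  refine ⟨⟨hp, ?_, hasDerivAt_isoscelesEnergy hγ _ _ _ _, ?_, ?_, ?_, hη.trans_le htop, ?_⟩, htop⟩
  · rw [mul_div_assoc]; linarith
  · unfold isoscelesSlope
    refine Continuous.sub (Continuous.div continuous_const (by fun_prop) fun u => ?_) (by fun_prop)
    have := hone u
    positivity
  · intro u hu v hv huv
    simp only [isoscelesSlope]
    have hu' : 0 ≤ u := hu
    have := hone u
    gcongr
  · simpa [isoscelesEnergy] using hE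
  · have h4 := kepler_end (μ₁ := μ₁) (E := E) hL
    have h5 : (μ₁ + μ₂) * (4 * μ₁ / L ^ 2 / √(1 + μ₂ * r₀ ^ 2 / μ₁ * (4 * μ₁ / L ^ 2) ^ 2)) ≤
        (μ₁ + μ₁) * (4 * μ₁ / L ^ 2) := by
      have := div_le_self (show 0 ≤ 4 * μ₁ / L ^ 2 by positivity) (hone (4 * μ₁ / L ^ 2))
      gcongr
    simp only [isoscelesEnergy]
    linarith

/-- A root of either energy is at least `-E / (2μ₁)`, by the bounds `firstOrderEnergy_le` and
`isoscelesEnergy_le`. -/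
theorem lower_bound_of_energy_le {e u : ℝ} (h₁ : 0 < μ₁) (hμ : μ₂ ≤ μ₁) (hu : 0 ≤ u)
    (he : e ≤ E + (μ₁ + μ₂) * u) (h0 : e = 0) : -E / (2 * μ₁) ≤ u := by
  rw [div_le_iff₀ (by positivity)]
  nlinarith

theorem firstOrderEnergy_le (h₂ : 0 ≤ μ₂) {u : ℝ} (hu : 0 ≤ u) :
    firstOrderEnergy μ₁ μ₂ r₀ L E u ≤ E + (μ₁ + μ₂) * u := by
  have h1 : 0 ≤ L ^ 2 / 2 * u ^ 2 := by positivity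
  have h2 : 0 ≤ μ₂ * r₀ ^ 2 / 2 * u ^ 3 := by positivity
  simp only [firstOrderEnergy]
  linarith

theorem isoscelesEnergy_le {γ : ℝ} (hγ : 0 ≤ γ) (h : 0 ≤ μ₁ + μ₂) {u : ℝ} (hu : 0 ≤ u) :
    isoscelesEnergy μ₁ μ₂ γ L E u ≤ E + (μ₁ + μ₂) * u := by
  have h1 : 0 ≤ L ^ 2 / 2 * u ^ 2 := by positivity
  have hs : 1 ≤ √(1 + γ * u ^ 2) := by
    rw [Real.one_le_sqrt]
    have : 0 ≤ γ * u ^ 2 := by positivity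
    linarith
  have h2 : (μ₁ + μ₂) * (u / √(1 + γ * u ^ 2)) ≤ (μ₁ + μ₂) * u :=
    mul_le_mul_of_nonneg_left (div_le_self hu hs) h
  simp only [isoscelesEnergy]
  linarith

/-- The cubic `C` is, up to the factor `ρ³ / E`, the first-order energy in `u = 1 / ρ`; its
third root is found from the product of the roots. -/
theorem orbitCubic_eq {a b : ℝ} (hE : E < 0) (ha : 0 < a) (hab : a < b) (h₂ : 0 < μ₂)
    (hr : 0 < r₀) (hQa : firstOrderEnergy μ₁ μ₂ r₀ L E a = 0)
    (hQb : firstOrderEnergy μ₁ μ₂ r₀ L E b = 0) :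
    μ₂ * r₀ ^ 2 / (2 * E) * a * b < 0 ∧ ∀ x, orbitCubic μ₁ μ₂ r₀ L E x =
      (x - a⁻¹) * (x - b⁻¹) * (x - μ₂ * r₀ ^ 2 / (2 * E) * a * b) := by
  have hb : 0 < b := ha.trans hab
  have hE0 : E ≠ 0 := hE.ne
  have hk : 0 < μ₂ * r₀ ^ 2 := by positivity
  refine ⟨?_, fun x => ?_⟩
  · have : μ₂ * r₀ ^ 2 / (2 * E) < 0 := div_neg_of_pos_of_neg hk (by linarith)
    have := mul_pos ha hb
    nlinarith
  · simp only [firstOrderEnergy] at hQa hQb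
    -- the divided differences of the two equations determine `μ₁ + μ₂` and `L²`
    have h1 : (μ₁ + μ₂) = L ^ 2 / 2 * (a + b) + μ₂ * r₀ ^ 2 / 2 * (a ^ 2 + a * b + b ^ 2) := by
      have : (b - a) * (μ₁ + μ₂ - (L ^ 2 / 2 * (a + b) +
          μ₂ * r₀ ^ 2 / 2 * (a ^ 2 + a * b + b ^ 2))) = 0 := by
        linear_combination hQb - hQa
      have := (mul_eq_zero.mp this).resolve_left (by linarith)
      linarith
    have h2 : L ^ 2 = (-2 * E - μ₂ * r₀ ^ 2 * a * b * (a + b)) / (a * b) := by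
      rw [eq_div_iff (by positivity)]
      rw [h1] at hQa
      linear_combination 2 * hQa
    simp only [orbitCubic, h1, h2]
    field_simp
    ring

end OrbitEnergies

/-! ### The differential equation of the orbit formula -/

section OrbitEquation

open Set

/-- The shift `(3 μ₂ r₀² u₀ + L²) / 24` of `℘` in the bracket, where `u₀ = 1 / ρmax`. -/
noncomputable def bracketShift (μ₂ r₀ L u₀ : ℝ) : ℝ := 1 / 24 * (3 * (μ₂ * r₀ ^ 2) * u₀ + L ^ 2)

/-- The value of `12 b² - g₂` for the shift `b` of the bracket, of first order in `μ₂`. -/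
noncomputable def bracketQuadratic (μ₁ μ₂ r₀ L u₀ : ℝ) : ℝ :=
  μ₂ * r₀ ^ 2 / 8 * (L ^ 2 * u₀ - μ₁) + 3 / 16 * (μ₂ * r₀ ^ 2) ^ 2 * u₀ ^ 2

/-- The value of `-4 b³ + g₂ b - g₃` for the shift `b` of the bracket, of second order in `μ₂`. -/
noncomputable def bracketCubic (μ₁ μ₂ r₀ L u₀ : ℝ) : ℝ :=
  (μ₂ * r₀ ^ 2) ^ 2 *
    (μ₁ * u₀ / 64 - L ^ 2 * u₀ ^ 2 / 128 - μ₂ * r₀ ^ 2 * u₀ ^ 3 / 128)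

variable {μ₁ μ₂ r₀ L E u₀ : ℝ} {Λ : PeriodPair}

theorem orbitFormula_eq (Λ : PeriodPair) (μ₁ μ₂ r₀ L R ψ : ℝ) :
    orbitFormula Λ μ₁ μ₂ r₀ L R ψ = ((firstOrderSlope μ₁ μ₂ r₀ L R⁻¹ / 4 : ℝ) : ℂ) *
      Λ.recipWeierstrassP (bracketShift μ₂ r₀ L R⁻¹ : ℝ) ((√2 / L * ψ : ℝ) : ℂ) := by
  unfold orbitFormula
  change _ = _ * Λ.recipWeierstrassP _ (orbitArg L ψ)
  by_cases hm : orbitArg L ψ ∈ Λ.lattice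
  · rw [if_pos hm, PeriodPair.recipWeierstrassP_of_mem hm, mul_zero]
  · rw [if_neg hm, PeriodPair.recipWeierstrassP_of_notMem hm]
    congr 2
    · rw [firstOrderSlope]; ring
    · simp only [orbitBracket, orbitArg, bracketShift]
      congr 2
      ring

theorem orbitBracket_ne_zero {R ψ : ℝ}
    (h : ((√2 / L * ψ : ℝ) : ℂ) ∈ Λ.recipRegular (bracketShift μ₂ r₀ L R⁻¹ : ℝ))
    (hm : orbitArg L ψ ∉ Λ.lattice) : orbitBracket Λ μ₂ r₀ L R ψ ≠ 0 := by
  have h1 := h.resolve_left hm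
  rw [bracketShift, mul_assoc 3 (μ₂ * r₀ ^ 2)] at h1
  rw [orbitBracket, orbitArg]
  convert h1 using 5
  ring

theorem sq_scale (L : ℝ) : (((√2 / L : ℝ) : ℂ)) ^ 2 = 2 / (L : ℂ) ^ 2 := by
  rw [← Complex.ofReal_pow, div_pow, Real.sq_sqrt zero_le_two]
  push_cast
  rfl

theorem recipForce_bracketShift (hΛ : HasInvariants Λ μ₁ μ₂ r₀ L) (y : ℂ) :
    Λ.recipForce (bracketShift μ₂ r₀ L u₀ : ℝ) y = 2 - 12 * (bracketShift μ₂ r₀ L u₀ : ℝ) * y +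
      3 / 2 * (bracketQuadratic μ₁ μ₂ r₀ L u₀ : ℝ) * y ^ 2 +
      2 * (bracketCubic μ₁ μ₂ r₀ L u₀ : ℝ) * y ^ 3 := by
  rw [PeriodPair.recipForce, hΛ.1, hΛ.2]
  have h1 : (12 * (bracketShift μ₂ r₀ L u₀ : ℝ) ^ 2 - (invG₂ μ₁ μ₂ r₀ L : ℝ) : ℂ) =
      (bracketQuadratic μ₁ μ₂ r₀ L u₀ : ℝ) := by
    simp only [bracketShift, invG₂, bracketQuadratic]
    push_cast
    ring
  have h2 : (-4 * (bracketShift μ₂ r₀ L u₀ : ℝ) ^ 3 + (invG₂ μ₁ μ₂ r₀ L : ℝ) *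
      (bracketShift μ₂ r₀ L u₀ : ℝ) - (invG₃ μ₁ μ₂ r₀ L : ℝ) : ℂ) =
      (bracketCubic μ₁ μ₂ r₀ L u₀ : ℝ) := by
    simp only [bracketShift, invG₂, invG₃, bracketCubic]
    push_cast
    ring
  rw [h1, h2]

/-- With `c` a quarter of the slope at `u₀`, the function `u₀ + c y` solves the first-order orbit
equation up to terms of second order in `μ₂`. -/
theorem recipForce_eq_slope (hΛ : HasInvariants Λ μ₁ μ₂ r₀ L) (y : ℂ) {c : ℝ}
    (hc : c = firstOrderSlope μ₁ μ₂ r₀ L u₀ / 4) :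
    c * (2 * Λ.recipForce (bracketShift μ₂ r₀ L u₀ : ℝ) y) =
      ((μ₁ + μ₂ - L ^ 2 * (u₀ + c * y) - 3 / 2 * (μ₂ * r₀ ^ 2) * (u₀ + c * y) ^ 2 : ℂ)) +
        (3 / 8 * μ₂ ^ 2 * r₀ ^ 2 * c * y ^ 2 +
          4 * c * (bracketCubic μ₁ μ₂ r₀ L u₀ : ℝ) * y ^ 3) := by
  rw [recipForce_bracketShift hΛ]
  have h1 : (bracketQuadratic μ₁ μ₂ r₀ L u₀ : ℂ) =
      μ₂ ^ 2 * r₀ ^ 2 / 8 - μ₂ * r₀ ^ 2 * c / 2 := by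
    rw [hc]; simp only [bracketQuadratic, firstOrderSlope]; push_cast; ring
  have h2 : (μ₁ + μ₂ : ℂ) = 4 * c + L ^ 2 * u₀ + 3 / 2 * (μ₂ * r₀ ^ 2) * u₀ ^ 2 := by
    rw [hc]; simp only [firstOrderSlope]; push_cast; ring
  rw [h1, h2]
  simp only [bracketShift]
  push_cast
  ring

theorem abs_bracketQuadratic_le {U : ℝ} (h₁ : 0 < μ₁) (h₂ : 0 < μ₂) (h₂' : μ₂ ≤ 1)
    (hu : u₀ ∈ Icc 0 U) : |bracketQuadratic μ₁ μ₂ r₀ L u₀| ≤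
      μ₂ * (r₀ ^ 2 / 8 * (L ^ 2 * U + μ₁) + 3 / 16 * (r₀ ^ 2) ^ 2 * U ^ 2) := by
  obtain ⟨h0, hU⟩ := hu
  have e1 : |μ₂ * r₀ ^ 2 / 8 * (L ^ 2 * u₀ - μ₁)| ≤ μ₂ * (r₀ ^ 2 / 8 * (L ^ 2 * U + μ₁)) := by
    rw [abs_mul, abs_of_nonneg (show 0 ≤ μ₂ * r₀ ^ 2 / 8 by positivity)]
    have : |L ^ 2 * u₀ - μ₁| ≤ L ^ 2 * U + μ₁ := by
      have h3 : L ^ 2 * u₀ ≤ L ^ 2 * U := by gcongr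
      have h4 : 0 ≤ L ^ 2 * u₀ := by positivity
      rw [abs_le]; constructor <;> linarith
    calc _ ≤ μ₂ * r₀ ^ 2 / 8 * (L ^ 2 * U + μ₁) := by gcongr
      _ = _ := by ring
  have e2 : |3 / 16 * (μ₂ * r₀ ^ 2) ^ 2 * u₀ ^ 2| ≤ μ₂ * (3 / 16 * (r₀ ^ 2) ^ 2 * U ^ 2) := by
    rw [abs_of_nonneg (by positivity)]
    have h3 : μ₂ ^ 2 ≤ μ₂ := by nlinarith
    calc _ = μ₂ ^ 2 * (3 / 16 * (r₀ ^ 2) ^ 2 * u₀ ^ 2) := by ring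
      _ ≤ _ := by gcongr
  calc _ ≤ _ := abs_add_le _ _
    _ ≤ _ := add_le_add e1 e2
    _ = _ := by ring

theorem abs_bracketCubic_le {U : ℝ} (h₁ : 0 < μ₁) (h₂ : 0 < μ₂) (h₂' : μ₂ ≤ 1)
    (hu : u₀ ∈ Icc 0 U) : |bracketCubic μ₁ μ₂ r₀ L u₀| ≤
      μ₂ ^ 2 * ((r₀ ^ 2) ^ 2 * (μ₁ * U + L ^ 2 * U ^ 2 + r₀ ^ 2 * U ^ 3)) := by
  obtain ⟨h0, hU⟩ := hu
  have hU0 := h0.trans hU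
  have e : |μ₁ * u₀ / 64 - L ^ 2 * u₀ ^ 2 / 128 - μ₂ * r₀ ^ 2 * u₀ ^ 3 / 128| ≤
      μ₁ * U + L ^ 2 * U ^ 2 + r₀ ^ 2 * U ^ 3 := by
    have h3 : μ₁ * u₀ ≤ μ₁ * U := by gcongr
    have h4 : L ^ 2 * u₀ ^ 2 ≤ L ^ 2 * U ^ 2 := by gcongr
    have h5 : μ₂ * r₀ ^ 2 * u₀ ^ 3 ≤ 1 * r₀ ^ 2 * U ^ 3 := by gcongr
    have h6 : 0 ≤ μ₁ * u₀ := by positivity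
    have h7 : 0 ≤ L ^ 2 * u₀ ^ 2 := by positivity
    have h8 : 0 ≤ μ₂ * r₀ ^ 2 * u₀ ^ 3 := by positivity
    rw [abs_le]; constructor <;> linarith
  rw [bracketCubic, abs_mul, abs_of_nonneg (by positivity)]
  calc _ ≤ (μ₂ * r₀ ^ 2) ^ 2 * (μ₁ * U + L ^ 2 * U ^ 2 + r₀ ^ 2 * U ^ 3) := by gcongr
    _ = _ := by ring

/-- In the variable `φ`, for small `μ₂`, the differential equation of `1 / (℘ + b)` is a small perturbation of the
linear equation `y'' = 4 / L² - y`. -/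
theorem exists_mass_norm_recipForce_le (h₁ : 0 < μ₁) (hL : L ≠ 0) {U B : ℝ} (hU : 0 ≤ U)
    (hB : 0 ≤ B) :
    ∃ δ > 0, ∀ μ₂ ∈ Ioo 0 δ, ∀ Λ : PeriodPair, HasInvariants Λ μ₁ μ₂ r₀ L → ∀ u₀ ∈ Icc 0 U,
      ∀ y : ℂ, ‖y‖ ≤ B → ‖(((√2 / L : ℝ) : ℂ)) ^ 2 *
        Λ.recipForce (bracketShift μ₂ r₀ L u₀ : ℝ) y‖ ≤ ‖y‖ + (4 / L ^ 2 + 1) := by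
  have hL2 : 0 < L ^ 2 := by positivity
  set Kq := r₀ ^ 2 / 8 * (L ^ 2 * U + μ₁) + 3 / 16 * (r₀ ^ 2) ^ 2 * U ^ 2 with hKq
  set Kc := (r₀ ^ 2) ^ 2 * (μ₁ * U + L ^ 2 * U ^ 2 + r₀ ^ 2 * U ^ 3) with hKc
  set N := (3 * r₀ ^ 2 * U * B + 3 * Kq * B ^ 2 + 4 * Kc * B ^ 3) / L ^ 2 with hN
  have hKq0 : 0 ≤ Kq := by positivity
  have hKc0 : 0 ≤ Kc := by positivity
  have hN0 : 0 ≤ N := by positivity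
  refine ⟨min 1 (1 / (N + 1)), lt_min one_pos (by positivity), ?_⟩
  rintro μ₂ ⟨h₂, hδ⟩ Λ hΛ u₀ hu₀ y hy
  have h₂' : μ₂ ≤ 1 := hδ.le.trans (min_le_left _ _)
  have hμN : μ₂ * N ≤ 1 := by
    have h3 := (le_div_iff₀ (by positivity)).mp (hδ.le.trans (min_le_right 1 (1 / (N + 1))))
    nlinarith
  have hq := abs_bracketQuadratic_le (r₀ := r₀) (L := L) h₁ h₂ h₂' hu₀
  have hc := abs_bracketCubic_le (r₀ := r₀) (L := L) h₁ h₂ h₂' hu₀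
  rw [← hKq] at hq
  rw [← hKc] at hc
  have hc' : |bracketCubic μ₁ μ₂ r₀ L u₀| ≤ μ₂ * Kc :=
    hc.trans (mul_le_mul_of_nonneg_right (by nlinarith) hKc0)
  have hLc : (L : ℂ) ≠ 0 := Complex.ofReal_ne_zero.mpr hL
  have hid : (((√2 / L : ℝ) : ℂ)) ^ 2 * Λ.recipForce (bracketShift μ₂ r₀ L u₀ : ℝ) y =
      ((4 / L ^ 2 : ℝ) : ℂ) - y + (-((3 * (μ₂ * r₀ ^ 2) * u₀ / L ^ 2 : ℝ) : ℂ) * y +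
        ((3 / L ^ 2 * bracketQuadratic μ₁ μ₂ r₀ L u₀ : ℝ) : ℂ) * y ^ 2 +
        ((4 / L ^ 2 * bracketCubic μ₁ μ₂ r₀ L u₀ : ℝ) : ℂ) * y ^ 3) := by
    rw [sq_scale L, recipForce_bracketShift hΛ]
    simp only [bracketShift]
    push_cast
    field_simp
    ring
  have e1 : ‖-((3 * (μ₂ * r₀ ^ 2) * u₀ / L ^ 2 : ℝ) : ℂ) * y‖ ≤
      μ₂ * (3 * r₀ ^ 2 * U * B / L ^ 2) := by
    have h0 := hu₀.1
    rw [norm_mul, norm_neg, Complex.norm_real, Real.norm_of_nonneg (by positivity)]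
    calc _ ≤ 3 * (μ₂ * r₀ ^ 2) * U / L ^ 2 * B := by gcongr; exact hu₀.2
      _ = _ := by ring
  have e2 : ‖((3 / L ^ 2 * bracketQuadratic μ₁ μ₂ r₀ L u₀ : ℝ) : ℂ) * y ^ 2‖ ≤
      μ₂ * (3 * Kq * B ^ 2 / L ^ 2) := by
    rw [norm_mul, norm_pow, Complex.norm_real, norm_mul, Real.norm_of_nonneg
      (show 0 ≤ 3 / L ^ 2 by positivity), Real.norm_eq_abs]
    calc _ ≤ 3 / L ^ 2 * (μ₂ * Kq) * B ^ 2 := by gcongr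
      _ = _ := by ring
  have e3 : ‖((4 / L ^ 2 * bracketCubic μ₁ μ₂ r₀ L u₀ : ℝ) : ℂ) * y ^ 3‖ ≤
      μ₂ * (4 * Kc * B ^ 3 / L ^ 2) := by
    rw [norm_mul, norm_pow, Complex.norm_real, norm_mul, Real.norm_of_nonneg
      (show 0 ≤ 4 / L ^ 2 by positivity), Real.norm_eq_abs]
    calc _ ≤ 4 / L ^ 2 * (μ₂ * Kc) * B ^ 3 := by gcongr
      _ = _ := by ring
  have e4 : ‖((4 / L ^ 2 : ℝ) : ℂ) - y‖ ≤ 4 / L ^ 2 + ‖y‖ := by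
    refine (norm_sub_le _ _).trans_eq ?_
    rw [Complex.norm_real, Real.norm_of_nonneg (by positivity)]
  rw [hid]
  have e5 : μ₂ * N = μ₂ * (3 * r₀ ^ 2 * U * B / L ^ 2) + μ₂ * (3 * Kq * B ^ 2 / L ^ 2) +
      μ₂ * (4 * Kc * B ^ 3 / L ^ 2) := by rw [hN]; ring
  refine (norm_add_le _ _).trans ?_
  have e6 := norm_add₃_le (a := -((3 * (μ₂ * r₀ ^ 2) * u₀ / L ^ 2 : ℝ) : ℂ) * y)
    (b := ((3 / L ^ 2 * bracketQuadratic μ₁ μ₂ r₀ L u₀ : ℝ) : ℂ) * y ^ 2)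
    (c := ((4 / L ^ 2 * bracketCubic μ₁ μ₂ r₀ L u₀ : ℝ) : ℂ) * y ^ 3)
  linarith

/-- The difference between the slope of an orbit at `u` and `L²` times the second derivative of
`u₀ + c y`. -/
theorem norm_slope_sub_recipForce_le (h₁ : 0 < μ₁) (hL : L ≠ 0) (h₂ : 0 < μ₂) (h₂' : μ₂ ≤ 1)
    {U B K : ℝ}
    (hΛ : HasInvariants Λ μ₁ μ₂ r₀ L) (hu₀ : u₀ ∈ Icc 0 U) {c : ℝ} (hc0 : 0 ≤ c)
    (hcμ : c ≤ μ₁) (hc : c = firstOrderSlope μ₁ μ₂ r₀ L u₀ / 4) {y : ℂ} (hy : ‖y‖ ≤ B) {u s : ℝ}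
    (hu : u ∈ Icc 0 U) (hs : |firstOrderSlope μ₁ μ₂ r₀ L u - s| ≤ K * μ₂ ^ 2) :
    ‖((s / L ^ 2 : ℝ) : ℂ) - c * ((((√2 / L : ℝ) : ℂ)) ^ 2 *
        Λ.recipForce (bracketShift μ₂ r₀ L u₀ : ℝ) y)‖ ≤
      (1 + 3 / 2 * r₀ ^ 2 * (2 * U + μ₁ * B) / L ^ 2) * ‖((u : ℂ) - u₀ - c * y)‖ +
      (K + (3 / 8 * r₀ ^ 2 * μ₁ * B ^ 2 + 4 * μ₁ *
        ((r₀ ^ 2) ^ 2 * (μ₁ * U + L ^ 2 * U ^ 2 + r₀ ^ 2 * U ^ 3)) * B ^ 3)) / L ^ 2 * μ₂ ^ 2 := by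
  have hL2 : 0 < L ^ 2 := by positivity
  have hLc : (L : ℂ) ≠ 0 := Complex.ofReal_ne_zero.mpr hL
  have hU : 0 ≤ U := hu.1.trans hu.2
  have hcub := abs_bracketCubic_le (r₀ := r₀) (L := L) h₁ h₂ h₂' hu₀
  set Kc := (r₀ ^ 2) ^ 2 * (μ₁ * U + L ^ 2 * U ^ 2 + r₀ ^ 2 * U ^ 3) with hKc
  set β := bracketCubic μ₁ μ₂ r₀ L u₀ with hβ
  have hfs := recipForce_eq_slope hΛ y hc
  have hid : ((s / L ^ 2 : ℝ) : ℂ) - c * ((((√2 / L : ℝ) : ℂ)) ^ 2 *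
        Λ.recipForce (bracketShift μ₂ r₀ L u₀ : ℝ) y) =
      ((1 / L ^ 2 : ℝ) : ℂ) * (-((firstOrderSlope μ₁ μ₂ r₀ L u - s : ℝ) : ℂ) +
        (-(L ^ 2 + 3 / 2 * (μ₂ * r₀ ^ 2) * (u + (u₀ + c * y))) * (u - u₀ - c * y)) +
        -(3 / 8 * μ₂ ^ 2 * r₀ ^ 2 * c * y ^ 2 + 4 * c * β * y ^ 3)) := by
    have h3 : c * ((((√2 / L : ℝ) : ℂ)) ^ 2 * Λ.recipForce (bracketShift μ₂ r₀ L u₀ : ℝ) y) =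
        (c * (2 * Λ.recipForce (bracketShift μ₂ r₀ L u₀ : ℝ) y)) / (L : ℂ) ^ 2 := by
      rw [sq_scale L]; ring
    rw [h3, hfs]
    simp only [firstOrderSlope]
    push_cast
    field_simp
    ring
  have e1 : ‖-((firstOrderSlope μ₁ μ₂ r₀ L u - s : ℝ) : ℂ)‖ ≤ K * μ₂ ^ 2 := by
    rwa [norm_neg, Complex.norm_real, Real.norm_eq_abs]
  have hw : ‖(u : ℂ) + (u₀ + c * y)‖ ≤ 2 * U + μ₁ * B := by
    have hn : ‖(c : ℂ) * y‖ ≤ μ₁ * B := by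
      rw [norm_mul, Complex.norm_real, Real.norm_of_nonneg hc0]; gcongr
    have hn1 : ‖(u : ℂ)‖ ≤ U := by
      rw [Complex.norm_real, Real.norm_of_nonneg hu.1]; exact hu.2
    have hn2 : ‖(u₀ : ℂ)‖ ≤ U := by
      rw [Complex.norm_real, Real.norm_of_nonneg hu₀.1]; exact hu₀.2
    have h3 := norm_add_le (u : ℂ) (u₀ + c * y)
    have h4 := norm_add_le (u₀ : ℂ) (c * y)
    linarith
  have e2 : ‖-((L : ℂ) ^ 2 + 3 / 2 * (μ₂ * r₀ ^ 2) * (u + (u₀ + c * y))) * (u - u₀ - c * y)‖ ≤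
      (L ^ 2 + 3 / 2 * r₀ ^ 2 * (2 * U + μ₁ * B)) * ‖((u : ℂ) - u₀ - c * y)‖ := by
    rw [norm_mul, norm_neg]
    gcongr
    refine (norm_add_le _ _).trans ?_
    have h3 : ‖(L : ℂ) ^ 2‖ = L ^ 2 := by
      rw [← Complex.ofReal_pow, Complex.norm_real, Real.norm_of_nonneg hL2.le]
    have h4 : ‖(3 / 2 * (μ₂ * r₀ ^ 2) * (u + (u₀ + c * y)) : ℂ)‖ =
        3 / 2 * (μ₂ * r₀ ^ 2) * ‖(u : ℂ) + (u₀ + c * y)‖ := by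
      rw [norm_mul, show (3 / 2 * (μ₂ * r₀ ^ 2) : ℂ) = ((3 / 2 * (μ₂ * r₀ ^ 2) : ℝ) : ℂ) by
        push_cast; ring, Complex.norm_real, Real.norm_of_nonneg (by positivity)]
    rw [h3, h4]
    have h5 : 3 / 2 * (μ₂ * r₀ ^ 2) ≤ 3 / 2 * r₀ ^ 2 := by
      have : 0 ≤ r₀ ^ 2 := by positivity
      nlinarith
    gcongr
  have e3 : ‖-(3 / 8 * μ₂ ^ 2 * r₀ ^ 2 * c * y ^ 2 + 4 * c * β * y ^ 3 : ℂ)‖ ≤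
      (3 / 8 * r₀ ^ 2 * μ₁ * B ^ 2 + 4 * μ₁ * Kc * B ^ 3) * μ₂ ^ 2 := by
    rw [norm_neg]
    refine (norm_add_le _ _).trans ?_
    have h3 : ‖(3 / 8 * μ₂ ^ 2 * r₀ ^ 2 * c * y ^ 2 : ℂ)‖ = 3 / 8 * μ₂ ^ 2 * r₀ ^ 2 * c * ‖y‖ ^ 2 := by
      rw [norm_mul, norm_pow, show (3 / 8 * μ₂ ^ 2 * r₀ ^ 2 * c : ℂ) =
        ((3 / 8 * μ₂ ^ 2 * r₀ ^ 2 * c : ℝ) : ℂ) by push_cast; ring, Complex.norm_real,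
        Real.norm_of_nonneg (by positivity)]
    have h4 : ‖(4 * c * β * y ^ 3 : ℂ)‖ = 4 * c * |β| * ‖y‖ ^ 3 := by
      rw [norm_mul, norm_pow, norm_mul, Complex.norm_real, Real.norm_eq_abs, norm_mul,
        Complex.norm_real, Real.norm_of_nonneg hc0, Complex.norm_ofNat]
    rw [h3, h4]
    calc _ ≤ 3 / 8 * μ₂ ^ 2 * r₀ ^ 2 * μ₁ * B ^ 2 + 4 * μ₁ * (μ₂ ^ 2 * Kc) * B ^ 3 := by gcongr
      _ = _ := by ring
  rw [hid, norm_mul, Complex.norm_real, Real.norm_of_nonneg (by positivity)]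
  have e4 := norm_add₃_le (a := -((firstOrderSlope μ₁ μ₂ r₀ L u - s : ℝ) : ℂ))
    (b := -((L : ℂ) ^ 2 + 3 / 2 * (μ₂ * r₀ ^ 2) * (u + (u₀ + c * y))) * (u - u₀ - c * y))
    (c := -(3 / 8 * μ₂ ^ 2 * r₀ ^ 2 * c * y ^ 2 + 4 * c * β * y ^ 3 : ℂ))
  have e5 := e4.trans (add_le_add (add_le_add e1 e2) e3)
  calc _ ≤ 1 / L ^ 2 * _ := mul_le_mul_of_nonneg_left e5 (by positivity)
    _ = _ := by field_simp; ring

end OrbitEquation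

/-! ### Comparison of an orbit with the orbit formula -/

section OrbitEstimate

open Set

variable {μ₁ r₀ L E : ℝ}

theorem exists_sub_eq_mul_of_hasDerivAt {φ φ' : ℝ → ℝ} (h : ∀ t, HasDerivAt φ (φ' t) t) (s t : ℝ) :
    ∃ c, φ t - φ s = φ' c * (t - s) := by
  have hc : Continuous φ := continuous_iff_continuousAt.mpr fun t => (h t).continuousAt
  rcases lt_trichotomy s t with hst | rfl | hst
  · obtain ⟨c, -, hc⟩ := exists_hasDerivAt_eq_slope φ φ' hst hc.continuousOn fun x _ => h x
    exact ⟨c, by rw [hc, div_mul_cancel₀ _ (sub_pos.mpr hst).ne']⟩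
  · exact ⟨s, by simp⟩
  · obtain ⟨c, -, hc⟩ := exists_hasDerivAt_eq_slope φ φ' hst hc.continuousOn fun x _ => h x
    refine ⟨c, ?_⟩
    have : φ s - φ t = φ' c * (s - t) := by rw [hc, div_mul_cancel₀ _ (sub_pos.mpr hst).ne']
    linarith

/-- An orbit whose radial energy is close to the first-order one, in a range of distances
`[1 / U, 1 / l]`, follows the orbit formula. Here `1 / ρ - u₀ - c y` and the derivative with
respect to the polar angle are compared by Grönwall's inequality in time. -/
theorem exists_orbit_estimate (h₁ : 0 < μ₁) (hL : L ≠ 0) {l U K₁ K₂ : ℝ} (hl : 0 < l)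
    (hU : 0 ≤ U) (hK₁ : 0 ≤ K₁) (A : ℝ) :
    ∃ δ > 0, ∃ K, ∀ μ₂ ∈ Ioo 0 δ, ∀ Λ : PeriodPair, HasInvariants Λ μ₁ μ₂ r₀ L →
      ∀ R : ℝ, R⁻¹ ∈ Icc 0 U → 0 ≤ firstOrderSlope μ₁ μ₂ r₀ L R⁻¹ →
      firstOrderSlope μ₁ μ₂ r₀ L R⁻¹ ≤ 2 * μ₁ →
      ∀ f V Q Q' ρ φ : ℝ → ℝ, IsCentralMotion f V L E ρ φ → HasRadialEnergy f V L E Q Q' →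
      (∀ t, (ρ t)⁻¹ ∈ Icc l U) →
      (∀ u ∈ Icc 0 U, |firstOrderSlope μ₁ μ₂ r₀ L u - Q' u| ≤ K₁ * μ₂ ^ 2) →
      ∀ t₀, deriv ρ t₀ = 0 → |(ρ t₀)⁻¹ - R⁻¹| ≤ K₂ * μ₂ ^ 2 →
      ∀ t, |φ t - φ t₀| ≤ A →
        ((√2 / L * (φ t - φ t₀) : ℝ) : ℂ) ∈ Λ.recipRegular (bracketShift μ₂ r₀ L R⁻¹ : ℝ) ∧
        ‖((1 / ρ t - 1 / R : ℝ) : ℂ) - orbitFormula Λ μ₁ μ₂ r₀ L R (φ t - φ t₀)‖ ≤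
          K * μ₂ ^ 2 := by
  have hL2 : 0 < L ^ 2 := by positivity
  have hLa : 0 < |L| := abs_pos.mpr hL
  -- `T` bounds the time and `A'` the angle on the relevant part of the orbit
  set T := A / (|L| * l ^ 2) with hT
  set A' := |L| * U ^ 2 * T with hA'
  set C := 4 / L ^ 2 + 1 with hC
  have hC0 : 0 ≤ C := by positivity
  set B := C * Real.exp A' + 1 with hB
  have hB0 : 0 ≤ B := by positivity
  obtain ⟨δ, hδ, hforce⟩ := exists_mass_norm_recipForce_le (r₀ := r₀) h₁ hL hU hB0
  set G := 1 + 3 / 2 * r₀ ^ 2 * (2 * U + μ₁ * B) / L ^ 2 with hG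
  set N := (K₁ + (3 / 8 * r₀ ^ 2 * μ₁ * B ^ 2 + 4 * μ₁ *
    ((r₀ ^ 2) ^ 2 * (μ₁ * U + L ^ 2 * U ^ 2 + r₀ ^ 2 * U ^ 3)) * B ^ 3)) / L ^ 2 with hN
  have hG1 : 1 ≤ G := by
    rw [hG]
    have : 0 ≤ 3 / 2 * r₀ ^ 2 * (2 * U + μ₁ * B) / L ^ 2 := by positivity
    linarith
  have hN0 : 0 ≤ N := by positivity
  clear_value G N
  refine ⟨min 1 δ, lt_min one_pos hδ,
    (K₂ + |L| * U ^ 2 * N) * Real.exp ((1 + |L| * U ^ 2 * G) * T), ?_⟩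
  rintro μ₂ ⟨h₂, hμ₂⟩ Λ hΛ R hR hs0 hs1 f V Q Q' ρ φ hM hQ hmem hslope t₀ hd₀ hu₀ t ht
  have h₂' : μ₂ ≤ 1 := hμ₂.le.trans (min_le_left _ _)
  have hμδ : μ₂ < δ := hμ₂.trans_le (min_le_right _ _)
  set u₀ := R⁻¹ with hu₀def
  set b : ℂ := ((bracketShift μ₂ r₀ L u₀ : ℝ) : ℂ) with hb
  set c := firstOrderSlope μ₁ μ₂ r₀ L u₀ / 4 with hc
  have hc0 : 0 ≤ c := by positivity
  have hcμ : c ≤ μ₁ := by linarith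
  set σ := √2 / L with hσ
  have hreg := PeriodPair.recipWeierstrassP_regular_and_bounded (Λ := Λ) (b := b) (σ := σ)
    (A := A') (B := B) hC0 (fun y hy => hforce μ₂ ⟨h₂, hμδ⟩ Λ hΛ u₀ hR y hy) (by linarith)
  have hφ : ∀ s, HasDerivAt φ (L * (ρ s)⁻¹ ^ 2) s := fun s => by
    have := hM.angular s
    rwa [div_eq_mul_inv, ← inv_pow] at this
  -- time is controlled by the angle, and conversely
  have htime : |t - t₀| ≤ T := by
    obtain ⟨s, hs⟩ := exists_sub_eq_mul_of_hasDerivAt hφ t₀ t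
    rw [hT, le_div_iff₀ (by positivity)]
    refine le_trans ?_ ht
    rw [hs, abs_mul, abs_mul, abs_of_nonneg (sq_nonneg (ρ s)⁻¹), mul_comm]
    have := (hmem s).1
    gcongr
  have hT0 : 0 ≤ T := (abs_nonneg _).trans htime
  have hangle : ∀ s, |s - t₀| ≤ T → |φ s - φ t₀| ≤ A' := by
    intro s hs
    obtain ⟨r, hr⟩ := exists_sub_eq_mul_of_hasDerivAt hφ t₀ s
    rw [hr, abs_mul, abs_mul, abs_of_nonneg (sq_nonneg (ρ r)⁻¹), hA']
    have h3 := (hmem r).2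
    have h4 := hl.le.trans (hmem r).1
    gcongr
  set Y : ℝ → ℂ := fun ψ => Λ.recipWeierstrassP b ((σ * ψ : ℝ) : ℂ) with hY
  set Y₁ : ℝ → ℂ := fun ψ => σ * deriv (Λ.recipWeierstrassP b) ((σ * ψ : ℝ) : ℂ) with hY₁
  set F : ℝ → ℂ := fun ψ => (σ : ℂ) ^ 2 * Λ.recipForce b (Y ψ) with hF
  set w : ℝ → ℝ := fun s => L * (ρ s)⁻¹ ^ 2 with hw
  have hD₁ : ∀ s, |s - t₀| ≤ T → HasDerivAt
      (fun s => (((ρ s)⁻¹ : ℝ) : ℂ) - u₀ - c * Y (φ s - φ t₀))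
      (w s * (((-deriv ρ s / L : ℝ) : ℂ) - c * Y₁ (φ s - φ t₀))) s := by
    intro s hs
    have e1 := ((hM.differentiable s).hasDerivAt.inv (hM.pos s).ne').ofReal_comp
    have e2 := (PeriodPair.hasDerivAt_recipWeierstrassP_real (hreg _ (hangle s hs)).1).scomp s
      ((hφ s).sub_const (φ t₀))
    have e3 := (e1.sub_const (u₀ : ℂ)).sub (e2.const_mul (c : ℂ))
    refine e3.congr_deriv ?_
    have hρ : (ρ s : ℂ) ≠ 0 := Complex.ofReal_ne_zero.mpr (hM.pos s).ne'
    have hLc : (L : ℂ) ≠ 0 := Complex.ofReal_ne_zero.mpr hL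
    simp only [hw, hY₁, Complex.real_smul]
    push_cast
    field_simp
  have hD₂ : ∀ s, |s - t₀| ≤ T → HasDerivAt
      (fun s => ((-deriv ρ s / L : ℝ) : ℂ) - c * Y₁ (φ s - φ t₀))
      (w s * (((Q' (ρ s)⁻¹ / L ^ 2 : ℝ) : ℂ) - c * F (φ s - φ t₀))) s := by
    intro s hs
    have e0 := hM.radial s
    rw [hQ.force _ (hM.pos s)] at e0
    have e1 := (e0.neg.div_const L).ofReal_comp
    have e2 := (PeriodPair.hasDerivAt_deriv_recipWeierstrassP_real
      (hreg _ (hangle s hs)).1).scomp s ((hφ s).sub_const (φ t₀))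
    have e3 := e1.sub (e2.const_mul (c : ℂ))
    refine e3.congr_deriv ?_
    have hLc : (L : ℂ) ≠ 0 := Complex.ofReal_ne_zero.mpr hL
    simp only [hw, hF, hY, Complex.real_smul]
    push_cast
    field_simp
  have hw_le : ∀ s, |w s| ≤ |L| * U ^ 2 := by
    intro s
    simp only [hw]
    rw [abs_mul, abs_of_nonneg (sq_nonneg (ρ s)⁻¹)]
    have h3 := (hmem s).2
    have h4 := hl.le.trans (hmem s).1
    gcongr
  have hY0 : Y (φ t₀ - φ t₀) = 0 := by
    simp [hY, PeriodPair.recipWeierstrassP_zero]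
  have hY₁0 : Y₁ (φ t₀ - φ t₀) = 0 := by
    simp [hY₁, PeriodPair.deriv_recipWeierstrassP_zero]
  have hgr := norm_le_of_norm_deriv_le
    (f := fun s => ((((ρ s)⁻¹ : ℝ) : ℂ) - u₀ - c * Y (φ s - φ t₀),
      ((-deriv ρ s / L : ℝ) : ℂ) - c * Y₁ (φ s - φ t₀)))
    (f' := fun s => (w s * (((-deriv ρ s / L : ℝ) : ℂ) - c * Y₁ (φ s - φ t₀)),
      w s * (((Q' (ρ s)⁻¹ / L ^ 2 : ℝ) : ℂ) - c * F (φ s - φ t₀))))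
    (δ := K₂ * μ₂ ^ 2) (K := 1 + |L| * U ^ 2 * G) (ε := |L| * U ^ 2 * (N * μ₂ ^ 2)) (a := t₀)
    (T := T) (by
      have : 0 ≤ |L| * U ^ 2 * G := by positivity
      linarith) (by positivity)
    (fun s hs => (hD₁ s hs).prodMk (hD₂ s hs))
    (by
      rw [hY0, hY₁0, hd₀, Prod.norm_def]
      have : ‖(((ρ t₀)⁻¹ : ℝ) : ℂ) - u₀‖ ≤ K₂ * μ₂ ^ 2 := by
        rwa [← Complex.ofReal_sub, Complex.norm_real, Real.norm_eq_abs]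
      rw [mul_zero, sub_zero, sub_zero, neg_zero, zero_div, Complex.ofReal_zero, norm_zero]
      exact max_le this ((abs_nonneg _).trans hu₀))
    (fun s hs => by
      have h3 := norm_slope_sub_recipForce_le h₁ hL h₂ h₂' hΛ hR hc0 hcμ hc
        (hreg _ (hangle s hs)).2.le (u := (ρ s)⁻¹) (s := Q' (ρ s)⁻¹) (K := K₁)
        ⟨hl.le.trans (hmem s).1, (hmem s).2⟩
        (hslope _ ⟨hl.le.trans (hmem s).1, (hmem s).2⟩)
      rw [← hG, ← hN] at h3
      set D₁ : ℂ := (((ρ s)⁻¹ : ℝ) : ℂ) - u₀ - c * Y (φ s - φ t₀) with hD₁'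
      set D₂ : ℂ := ((-deriv ρ s / L : ℝ) : ℂ) - c * Y₁ (φ s - φ t₀) with hD₂'
      have h3' : ‖((Q' (ρ s)⁻¹ / L ^ 2 : ℝ) : ℂ) - c * F (φ s - φ t₀)‖ ≤
          G * ‖D₁‖ + N * μ₂ ^ 2 := h3
      have h4 : ‖D₁‖ ≤ ‖(D₁, D₂)‖ := norm_fst_le (D₁, D₂)
      have h5 : ‖D₂‖ ≤ ‖(D₁, D₂)‖ := norm_snd_le (D₁, D₂)
      have h6 := hw_le s
      have h7 : 0 ≤ ‖(D₁, D₂)‖ := norm_nonneg _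
      have h8 : 0 ≤ N * μ₂ ^ 2 := by positivity
      have hW0 : 0 ≤ |L| * U ^ 2 := by positivity
      rw [Prod.norm_def]
      refine max_le ?_ ?_
      · rw [norm_mul, Complex.norm_real, Real.norm_eq_abs]
        calc |w s| * ‖D₂‖ ≤ |L| * U ^ 2 * ‖(D₁, D₂)‖ := by gcongr
          _ ≤ |L| * U ^ 2 * G * ‖(D₁, D₂)‖ := by
              rw [mul_assoc (|L| * U ^ 2)]
              gcongr
              exact le_mul_of_one_le_left h7 hG1
          _ ≤ _ := by linarith [mul_nonneg hW0 h8]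
      · rw [norm_mul, Complex.norm_real, Real.norm_eq_abs]
        calc |w s| * _ ≤ |L| * U ^ 2 * (G * ‖(D₁, D₂)‖ + N * μ₂ ^ 2) := by
              refine mul_le_mul h6 (h3'.trans ?_) (norm_nonneg _) hW0
              gcongr
          _ = |L| * U ^ 2 * G * ‖(D₁, D₂)‖ + |L| * U ^ 2 * (N * μ₂ ^ 2) := by ring
          _ ≤ _ := by linarith)
    t htime
  refine ⟨(hreg _ (hangle t htime)).1, ?_⟩
  have h3 := (norm_fst_le _).trans hgr
  have hid : ((1 / ρ t - 1 / R : ℝ) : ℂ) - orbitFormula Λ μ₁ μ₂ r₀ L R (φ t - φ t₀) =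
      (((ρ t)⁻¹ : ℝ) : ℂ) - u₀ - c * Y (φ t - φ t₀) := by
    rw [orbitFormula_eq, one_div, one_div, Complex.ofReal_sub]
  rw [hid]
  refine h3.trans (le_of_eq ?_)
  ring

end OrbitEstimate

/-! ### Invariants and apsidal distances of the orbits -/

section OrbitTheorem

open Set

variable {μ₁ μ₂ r₀ L E : ℝ}

theorem exists_hasInvariants (h₁ : 0 < μ₁) (h₂ : 0 < μ₂) (hr : 0 < r₀) :
    ∃ Λ : PeriodPair, HasInvariants Λ μ₁ μ₂ r₀ L := by
  refine exists_periodPair_of_discriminant_pos ?_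
  set s := μ₁ * μ₂ * r₀ ^ 2 with hs
  have hs0 : 0 < s := by positivity
  have hid : invG₂ μ₁ μ₂ r₀ L ^ 3 - 27 * invG₃ μ₁ μ₂ r₀ L ^ 2 =
      s ^ 2 * L ^ 4 / 4096 + s ^ 3 / 512 := by
    simp only [invG₂, invG₃, hs]; ring
  have : 0 < s ^ 2 * L ^ 4 / 4096 + s ^ 3 / 512 := by positivity
  linarith

theorem abs_inv_sub_inv_le {x y l C : ℝ} (hl : 0 < l) (hx : l ≤ x) (hy : l ≤ y)
    (h : |x - y| ≤ C) : |x⁻¹ - y⁻¹| ≤ C / l ^ 2 := by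
  have hx0 := hl.trans_le hx
  have hy0 := hl.trans_le hy
  have hC : 0 ≤ C := (abs_nonneg _).trans h
  rw [inv_sub_inv hx0.ne' hy0.ne', abs_div, abs_of_pos (mul_pos hx0 hy0), abs_sub_comm]
  rw [pow_two]
  gcongr

/-- The roots of the two radial energies, which are the inverse apsidal distances, agree up to
second order in `μ₂`. -/
theorem exists_roots_close (h₁ : 0 < μ₁) (hr : 0 < r₀) (hL : L ≠ 0) (hE : E < 0)
    (hE' : -(μ₁ ^ 2 / (2 * L ^ 2)) < E) :
    ∃ K, ∀ μ₂ ∈ Ioo 0 (smallMass μ₁ r₀ L E), ∀ a b,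
      a ∈ Ioo 0 (μ₁ / L ^ 2) → b ∈ Ioo (μ₁ / L ^ 2) (4 * μ₁ / L ^ 2) →
      firstOrderEnergy μ₁ μ₂ r₀ L E a = 0 → firstOrderEnergy μ₁ μ₂ r₀ L E b = 0 →
      -E / (2 * μ₁) ≤ a ∧ ∃ a₂ ∈ Ioo 0 (μ₁ / L ^ 2), ∃ b₂ ∈ Ioo (μ₁ / L ^ 2) (4 * μ₁ / L ^ 2),
        isoscelesEnergy μ₁ μ₂ (μ₂ * r₀ ^ 2 / μ₁) L E a₂ = 0 ∧
        isoscelesEnergy μ₁ μ₂ (μ₂ * r₀ ^ 2 / μ₁) L E b₂ = 0 ∧ -E / (2 * μ₁) ≤ a₂ ∧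
        |a₂ - a| ≤ K * μ₂ ^ 2 ∧ |b₂ - b| ≤ K * μ₂ ^ 2 := by
  have hL2 : 0 < L ^ 2 := by positivity
  set p := μ₁ / L ^ 2 with hp
  set U := 4 * μ₁ / L ^ 2 with hU
  have hp0 : 0 < p := by positivity
  have hpU : p ≤ U := by rw [hp, hU, mul_div_assoc]; linarith
  set Ke := 2 * μ₁ * U * (r₀ ^ 2 / μ₁ * U ^ 2) ^ 2 + r₀ ^ 2 / (2 * μ₁) * U ^ 3 with hKe
  have hU0 := hp0.le.trans hpU
  have hKe0 : 0 ≤ Ke := by positivity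
  have hη := wellHeight_pos hE'
  refine ⟨U * Ke / wellHeight μ₁ L E, ?_⟩
  rintro μ₂ ⟨h₂, hδ⟩ a b ha hb hQa hQb
  have hμ : μ₂ ≤ μ₁ := hδ.le.trans ((min_le_left _ _).trans (min_le_left _ _))
  have hγ : 0 ≤ μ₂ * r₀ ^ 2 / μ₁ := by positivity
  obtain ⟨hW, hWp⟩ := firstOrder_concaveWell h₁ hr hL hE hE' h₂ hδ
  obtain ⟨hW₂, hW₂p⟩ := isosceles_concaveWell h₁ hr hL hE hE' h₂ hδ
  obtain ⟨a₂, b₂, ha₂, ha₂p, hpb₂, hb₂U, hQa₂, hQb₂⟩ := hW₂.exists_roots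
  have hdiff : ∀ u ∈ Icc 0 U, |firstOrderEnergy μ₁ μ₂ r₀ L E u -
      isoscelesEnergy μ₁ μ₂ (μ₂ * r₀ ^ 2 / μ₁) L E u| ≤ Ke * μ₂ ^ 2 := fun u hu =>
    abs_energy_sub_le h₁ h₂ hμ hu.1 hu.2
  refine ⟨lower_bound_of_energy_le h₁ hμ ha.1.le (firstOrderEnergy_le h₂.le ha.1.le) hQa,
    a₂, ⟨ha₂, ha₂p⟩, b₂, ⟨hpb₂, hb₂U⟩, hQa₂, hQb₂,
    lower_bound_of_energy_le h₁ hμ ha₂.le (isoscelesEnergy_le hγ (by positivity) ha₂.le) hQa₂,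
    ?_, ?_⟩
  · refine (hW.abs_lower_root_sub_le hW₂ hη hWp hW₂p ha.1.le ha.2 hQa ha₂.le ha₂p hQa₂
      fun u hu => hdiff u ⟨hu.1, hu.2.trans hpU⟩).trans ?_
    calc p * (Ke * μ₂ ^ 2) / wellHeight μ₁ L E ≤ U * (Ke * μ₂ ^ 2) / wellHeight μ₁ L E := by
          gcongr
      _ = _ := by ring
  · refine (hW.abs_upper_root_sub_le hW₂ hη hWp hW₂p hb.1 hb.2.le hQb hpb₂ hb₂U.le hQb₂
      hdiff).trans (le_of_eq ?_)
    ring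

end OrbitTheorem

theorem theorem3p3 (μ₁ r₀ L E : ℝ) (hμ₁ : 0 < μ₁) (hr₀ : 0 < r₀) (hL : L ≠ 0)
    (hE : E < 0) (hE' : -(μ₁ ^ 2 / (2 * L ^ 2)) < E) :
    ∃ δ > 0, ∃ K : ℝ, ∃ ρmax ρmin ρ₃ : ℝ → ℝ,
      (∀ μ₂ ∈ Set.Ioo 0 δ,
        -- the roots of the cubic
        (ρmin μ₂ < ρmax μ₂ ∧ 0 < ρmin μ₂ ∧ ρ₃ μ₂ < 0 ∧
          ∀ x, orbitCubic μ₁ μ₂ r₀ L E x = (x - ρmax μ₂) * (x - ρmin μ₂) * (x - ρ₃ μ₂)) ∧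
        -- the Weierstrass function with invariants `g₂`, `g₃` exists
        (∃ Λ : PeriodPair, HasInvariants Λ μ₁ μ₂ r₀ L) ∧
        -- the range of the first-order orbit
        (∀ ρ φ : ℝ → ℝ, IsFirstOrderOrbit μ₁ μ₂ r₀ L E ρ φ →
          IsGreatest (Set.range ρ) (ρmax μ₂) ∧ IsLeast (Set.range ρ) (ρmin μ₂) ∧
          ∀ t, ρ t ∈ Set.Ioo (ρmin μ₂) (ρmax μ₂) ↔ deriv ρ t ≠ 0) ∧
        -- the range of the isosceles triangle orbit, to first order
        (∀ ρ φ : ℝ → ℝ, IsIsoscelesOrbit μ₁ μ₂ r₀ L E ρ φ →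
          ∃ M m : ℝ, IsGreatest (Set.range ρ) M ∧ IsLeast (Set.range ρ) m ∧
            |M - ρmax μ₂| ≤ K * μ₂ ^ 2 ∧ |m - ρmin μ₂| ≤ K * μ₂ ^ 2)) ∧
      -- the equation of the orbit, correct to first order, locally uniformly in the polar angle
      ∀ A : ℝ, ∃ δ' ∈ Set.Ioc 0 δ, ∃ K' : ℝ, ∀ μ₂ ∈ Set.Ioo 0 δ', ∀ Λ : PeriodPair,
        HasInvariants Λ μ₁ μ₂ r₀ L →
        ∀ ρ φ : ℝ → ℝ,
          (IsIsoscelesOrbit μ₁ μ₂ r₀ L E ρ φ ∨ IsFirstOrderOrbit μ₁ μ₂ r₀ L E ρ φ) →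
        ∀ t₀, (∀ t, ρ t ≤ ρ t₀) → ∀ t, |φ t - φ t₀| ≤ A →
          (orbitArg L (φ t - φ t₀) ∉ Λ.lattice →
            orbitBracket Λ μ₂ r₀ L (ρmax μ₂) (φ t - φ t₀) ≠ 0) ∧
          ‖((1 / ρ t - 1 / ρmax μ₂ : ℝ) : ℂ) -
              orbitFormula Λ μ₁ μ₂ r₀ L (ρmax μ₂) (φ t - φ t₀)‖ ≤ K' * μ₂ ^ 2 := by
  have hL2 : 0 < L ^ 2 := by positivity
  set p := μ₁ / L ^ 2 with hp
  set U := 4 * μ₁ / L ^ 2 with hU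
  set l := -E / (2 * μ₁) with hl
  have hp0 : 0 < p := by positivity
  have hU0 : 0 ≤ U := by positivity
  have hl0 : 0 < l := div_pos (neg_pos.mpr hE) (by positivity)
  obtain ⟨Kr, hKr⟩ := exists_roots_close hμ₁ hr₀ hL hE hE'
  have hroots : ∀ μ₂ ∈ Set.Ioo 0 (smallMass μ₁ r₀ L E), ∃ a b : ℝ, 0 < a ∧ a < p ∧ p < b ∧ b < U ∧
      firstOrderEnergy μ₁ μ₂ r₀ L E a = 0 ∧ firstOrderEnergy μ₁ μ₂ r₀ L E b = 0 := fun μ₂ h =>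
    (firstOrder_concaveWell hμ₁ hr₀ hL hE hE' h.1 h.2).1.exists_roots
  choose! a b ha hap hpb hbU hQa hQb using hroots
  refine ⟨smallMass μ₁ r₀ L E, smallMass_pos hμ₁ hr₀ hL hE', Kr / l ^ 2, fun μ₂ => (a μ₂)⁻¹,
    fun μ₂ => (b μ₂)⁻¹, fun μ₂ => μ₂ * r₀ ^ 2 / (2 * E) * a μ₂ * b μ₂, ?_, ?_⟩
  · intro μ₂ hμ
    have hab : a μ₂ < b μ₂ := (hap μ₂ hμ).trans (hpb μ₂ hμ)
    obtain ⟨h₃, hcubic⟩ := orbitCubic_eq hE (ha μ₂ hμ) hab hμ.1 hr₀ (hQa μ₂ hμ) (hQb μ₂ hμ)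
    refine ⟨⟨inv_strictAnti₀ (ha μ₂ hμ) hab, inv_pos.mpr ((ha μ₂ hμ).trans hab), h₃, hcubic⟩,
      exists_hasInvariants hμ₁ hμ.1 hr₀, ?_, ?_⟩
    · intro ρ φ hO
      exact IsCentralMotion.range_of_concaveWell hO (firstOrder_hasRadialEnergy _ _ _ _ _)
        (firstOrder_concaveWell hμ₁ hr₀ hL hE hE' hμ.1 hμ.2).1 (ha μ₂ hμ) (hap μ₂ hμ) (hpb μ₂ hμ)
        (hQa μ₂ hμ) (hQb μ₂ hμ)
    · intro ρ φ hO
      obtain ⟨hla, a₂, ha₂, b₂, hb₂, hQa₂, hQb₂, hla₂, hda, hdb⟩ := hKr μ₂ hμ (a μ₂) (b μ₂)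
        ⟨ha μ₂ hμ, hap μ₂ hμ⟩ ⟨hpb μ₂ hμ, hbU μ₂ hμ⟩ (hQa μ₂ hμ) (hQb μ₂ hμ)
      have hγ : 0 ≤ μ₂ * r₀ ^ 2 / μ₁ := div_nonneg (mul_nonneg hμ.1.le (sq_nonneg _)) hμ₁.le
      simp only [IsIsoscelesOrbit, cSq_eq r₀ hμ₁ hμ.1] at hO
      obtain ⟨hM, hm, -⟩ := hO.range_of_concaveWell (isosceles_hasRadialEnergy hγ _ _ _ _)
        (isosceles_concaveWell hμ₁ hr₀ hL hE hE' hμ.1 hμ.2).1 ha₂.1 ha₂.2 hb₂.1 hQa₂ hQb₂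
      refine ⟨_, _, hM, hm, ?_, ?_⟩
      · refine (abs_inv_sub_inv_le hl0 hla₂ hla hda).trans (le_of_eq ?_)
        ring
      · refine (abs_inv_sub_inv_le hl0 (hla₂.trans (ha₂.2.trans hb₂.1).le) (hla.trans hab.le)
          hdb).trans (le_of_eq ?_)
        ring
  · intro A
    set K₁ := 2 * μ₁ * (2 * (r₀ ^ 2 / μ₁ * U ^ 2) ^ 2) + 3 * r₀ ^ 2 / (2 * μ₁) * U ^ 2 with hK₁
    have hK₁0 : 0 ≤ K₁ := by positivity
    obtain ⟨δ, hδ, K', hest⟩ := exists_orbit_estimate (r₀ := r₀) (E := E) (K₂ := Kr) hμ₁ hL hl0 hU0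
      hK₁0 A
    refine ⟨min δ (smallMass μ₁ r₀ L E),
      ⟨lt_min hδ (smallMass_pos hμ₁ hr₀ hL hE'), min_le_right _ _⟩, K', ?_⟩
    intro μ₂ hμδ Λ hΛ ρ φ hO t₀ ht₀ t ht
    have hμ : μ₂ ∈ Set.Ioo 0 (smallMass μ₁ r₀ L E) :=
      ⟨hμδ.1, hμδ.2.trans_le (min_le_right _ _)⟩
    have hμ' : μ₂ ∈ Set.Ioo 0 δ := ⟨hμδ.1, hμδ.2.trans_le (min_le_left _ _)⟩
    have hμμ : μ₂ ≤ μ₁ := hμ.2.le.trans ((min_le_left _ _).trans (min_le_left _ _))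
    have hγ : 0 ≤ μ₂ * r₀ ^ 2 / μ₁ := div_nonneg (mul_nonneg hμ.1.le (sq_nonneg _)) hμ₁.le
    have hW := (firstOrder_concaveWell hμ₁ hr₀ hL hE hE' hμ.1 hμ.2).1
    obtain ⟨hla, a₂, ha₂, b₂, hb₂, hQa₂, hQb₂, hla₂, hda, hdb⟩ := hKr μ₂ hμ (a μ₂) (b μ₂)
      ⟨ha μ₂ hμ, hap μ₂ hμ⟩ ⟨hpb μ₂ hμ, hbU μ₂ hμ⟩ (hQa μ₂ hμ) (hQb μ₂ hμ)
    have hR : ((a μ₂)⁻¹)⁻¹ ∈ Set.Icc 0 U := by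
      rw [inv_inv]
      exact ⟨(ha μ₂ hμ).le, ((hap μ₂ hμ).trans hW.lt).le⟩
    have hs0 : 0 ≤ firstOrderSlope μ₁ μ₂ r₀ L ((a μ₂)⁻¹)⁻¹ := by
      rw [inv_inv]
      exact (hW.deriv_pos_of_root (ha μ₂ hμ).le (hap μ₂ hμ) (hQa μ₂ hμ)).le
    have hs1 : firstOrderSlope μ₁ μ₂ r₀ L ((a μ₂)⁻¹)⁻¹ ≤ 2 * μ₁ := by
      rw [inv_inv, firstOrderSlope]
      have h1 : 0 ≤ L ^ 2 * a μ₂ := mul_nonneg hL2.le (ha μ₂ hμ).le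
      have h2 : 0 ≤ 3 / 2 * (μ₂ * r₀ ^ 2) * a μ₂ ^ 2 := by
        have := hμ.1
        positivity
      linarith
    have hd₀ : deriv ρ t₀ = 0 :=
      IsLocalMax.deriv_eq_zero (Filter.Eventually.of_forall ht₀)
    have hmain : ((√2 / L * (φ t - φ t₀) : ℝ) : ℂ) ∈
          Λ.recipRegular (bracketShift μ₂ r₀ L ((a μ₂)⁻¹)⁻¹ : ℝ) ∧
        ‖((1 / ρ t - 1 / (a μ₂)⁻¹ : ℝ) : ℂ) -
          orbitFormula Λ μ₁ μ₂ r₀ L (a μ₂)⁻¹ (φ t - φ t₀)‖ ≤ K' * μ₂ ^ 2 := by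
      rcases hO with hO | hO
      · simp only [IsIsoscelesOrbit, cSq_eq r₀ hμ₁ hμ.1] at hO
        have hW₂ := (isosceles_concaveWell hμ₁ hr₀ hL hE hE' hμ.1 hμ.2).1
        have hQ₂ := isosceles_hasRadialEnergy hγ μ₁ μ₂ L E
        have hg := (hO.range_of_concaveWell hQ₂ hW₂ ha₂.1 ha₂.2 hb₂.1 hQa₂ hQb₂).1
        have hmax : ρ t₀ = a₂⁻¹ :=
          le_antisymm (hg.2 ⟨t₀, rfl⟩) (by obtain ⟨s, hs⟩ := hg.1; exact hs ▸ ht₀ s)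
        refine hest μ₂ hμ' Λ hΛ _ hR hs0 hs1 _ _ _ _ ρ φ hO hQ₂ (fun s => ?_)
          (fun u hu => abs_slope_sub_le hμ₁ hμ.1 hμμ hu.1 hu.2) t₀ hd₀ ?_ t ht
        · have h := hO.inv_mem_Icc hQ₂ hW₂ ha₂.2 hb₂.1 hQa₂ hQb₂ s
          exact ⟨hla₂.trans h.1, h.2.trans hb₂.2.le⟩
        · rwa [hmax, inv_inv, inv_inv]
      · have hQ₁ := firstOrder_hasRadialEnergy μ₁ μ₂ r₀ L E
        have hO' : IsCentralMotion _ _ L E ρ φ := hO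
        have hg := (hO'.range_of_concaveWell hQ₁ hW (ha μ₂ hμ) (hap μ₂ hμ) (hpb μ₂ hμ)
          (hQa μ₂ hμ) (hQb μ₂ hμ)).1
        have hmax : ρ t₀ = (a μ₂)⁻¹ :=
          le_antisymm (hg.2 ⟨t₀, rfl⟩) (by obtain ⟨s, hs⟩ := hg.1; exact hs ▸ ht₀ s)
        refine hest μ₂ hμ' Λ hΛ _ hR hs0 hs1 _ _ _ _ ρ φ hO' hQ₁ (fun s => ?_)
          (fun u hu => ?_) t₀ hd₀ ?_ t ht
        · have h := hO'.inv_mem_Icc hQ₁ hW (hap μ₂ hμ) (hpb μ₂ hμ) (hQa μ₂ hμ) (hQb μ₂ hμ) s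
          exact ⟨hla.trans h.1, h.2.trans (hbU μ₂ hμ).le⟩
        · rw [sub_self, abs_zero]; positivity
        · rw [hmax, sub_self, abs_zero]; exact (abs_nonneg _).trans hda
    exact ⟨fun hm => orbitBracket_ne_zero hmain.1 hm, hmain.2⟩
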